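/- **Setting.** A dimension function is a map $\Phi:(0,1)\to[0,\infty)$ such that $x^{1+\Phi(x)}$ decreases to $0$ as $x\downarrow 0$. It is called small if $\Phi(x)\ll \log|\log x|/|\log x|$, that is, there are $\delta>0$ and a function $A$ with $A(x)\to\infty$ as $x\to0^+$ and $\log|\log x|/|\log x|\ge A(x)\Phi(x)$ for $0<x<\delta$. For a Borel probability measure $\mu$ on a metric space, the upper $\Phi$-dimension is $$\overline{\dim}_\Phi\mu=\inf\Big\{d\in\mathbb R:\ \exists C_1,C_2>0\ \ \forall\, 0<r<R^{1+\Phi(R)}\le R\le C_1,\ R<1,\ \forall x\in\operatorname{supp}\mu:\ \tfrac{\mu(B(x,R))}{\mu(B(x,r))}\le C_2\big(\tfrac Rr\big)^d\Big\}$$ and the lower $\Phi$-dimension is $$\underline{\dim}_\Phi\mu=\sup\Big\{d\in\mathbb R:\ \exists C_1,C_2>0\ \ \forall\, 0<r<R^{1+\Phi(R)}\le R\le C_1,\ R<1,\ \forall x\in\operatorname{supp}\mu:\ \tfrac{\mu(B(x,R))}{\mu(B(x,r))}\ge C_2\big(\tfrac Rr\big)^d\Big\}$$ (extended reals; $B$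 denotes open balls). An $r$-similarity of $I\subseteq\mathbb R^D$ is a subset $J\subseteq I$ with $J=S(I)$ for a similarity $S$ of contraction factor $r$. A family $J_1,\dots,J_t$ of $r$-similarities of $I$ is $\tau$-separated if $d(J_i,J_j)\ge\tau\, r\operatorname{diam}(I)$ for $i\ne j$. Fix a compact set $I_0\subseteq\mathbb R^D$ of diameter $1$ with non-empty interior, $0<\tau<1$, and for each $t\ge2$ a number $\rho_t\in(0,1/2]$ such that for every $0<r\le\rho_t$ there is a $\tau$-separated family of $t$ many $r$-similarities of $I_0$. Let $\mathcal S_t=\{p\in(0,1)^t:\sum_i p^{(i)}=1\}$, let $\Omega_0=\bigsqcup_{t\ge2}(0,\rho_t]\times\mathcal S_t$, let $\pi$ be a Borel probability measure on $\Omega_0$, and let $\mathbb P=\pi^{\mathbb N}$ on $\Omega=\Omega_0^{\mathbb N}$. Write $\omega\in\Omega$ as an i.i.d. sequence $(T_n,r_n,p_n)_{n\ge1}$ (number of children, ratio, probability vector), and put $M_n=\max_j p_n^{(j)}$, $m_n=\min_j p_n^{(j)}$. Assume that there is $A>0$ with $\mathbb E(e^{-\lambda\log r_1})<\infty$ for all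 $|\lambda|\le A$. For each $\omega\in\Omega$ choose Moran sets as follows: $I_0$ is the Moran set of step $0$, and for each Moran set $I$ of step $n$ choose a $\tau$-separated family of $T_{n+1}(\omega)$ many $r_{n+1}(\omega)$-similarities $I^{(1)},\dots,I^{(T_{n+1})}$ of $I$ (its children, of step $n+1$). Let $\mu_\omega$ be the Borel probability measure, supported on the intersection over $n$ of the unions of the Moran sets of step $n$, with $\mu_\omega(I_0)=1$ and $\mu_\omega(I^{(j)})=\mu_\omega(I)\,p_{n+1}^{(j)}$. Put $$\alpha=\operatorname{ess\,sup}\frac{\log m_1}{\log r_1},\qquad \beta=\operatorname{ess\,inf}\frac{\log M_1}{\log r_1}.$$ **Theorem.** There is a measurable set $\Gamma\subseteq\Omega$ with $\mathbb P(\Gamma)=1$ and the following properties. (i) $\underline{\dim}_\Phi\mu_\omega\le\beta$ and $\overline{\dim}_\Phi\mu_\omega\ge\alpha$ for all small dimension functions $\Phi$ and all $\omega\in\Gamma$. (ii) If $\operatorname{ess\,inf}M_1>0$ or $\operatorname{ess\,inf}r_1>0$, then $\underline{\dim}_\Phi\mu_\omega\ge\beta$ for all dimension functions $\Phi$ and all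 $\omega\in\Gamma$. (iii) If $\operatorname{ess\,inf}m_1>0$ or $\operatorname{ess\,inf}r_1>0$, then $\overline{\dim}_\Phi\mu_\omega\le\alpha$ for all dimension functions $\Phi$ and all $\omega\in\Gamma$. -/

import Mathlib

open MeasureTheory Filter Topology Set

noncomputable section

namespace RandomMoran

/-! ### Dimension functions and the upper and lower Phi-dimensions of a measure -/

/-- `Φ : (0,1) → [0,∞)` is a dimension function if `x ^ (1 + Φ x)` decreases to `0` as `x`
decreases to `0`. Only the values of `Φ` on `(0,1)` matter. -/
structure IsDimensionFunction (Φ : ℝ → ℝ) : Prop where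
  nonneg : ∀ x ∈ Ioo (0 : ℝ) 1, 0 ≤ Φ x
  monotoneOn : MonotoneOn (fun x : ℝ => x ^ (1 + Φ x)) (Ioo 0 1)
  tendsto_zero : Tendsto (fun x : ℝ => x ^ (1 + Φ x)) (𝓝[>] 0) (𝓝 0)

/-- `f ≫ g` near `0`: there is `A` with `A x → ∞` as `x → 0+` and `f x ≥ A x * g x` for small
positive `x`. -/
def MuchGreater (f g : ℝ → ℝ) : Prop :=
  ∃ (A : ℝ → ℝ) (δ : ℝ), 0 < δ ∧ (∀ x ∈ Ioo 0 δ, A x * g x ≤ f x) ∧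
    Tendsto A (𝓝[>] 0) atTop

/-- A small dimension function: `Φ(x) ≪ log |log x| / |log x|`. -/
def IsSmallDimensionFunction (Φ : ℝ → ℝ) : Prop :=
  IsDimensionFunction Φ ∧ MuchGreater (fun x => Real.log |Real.log x| / |Real.log x|) Φ

section Dimensions

variable {X : Type*} [PseudoMetricSpace X] [MeasurableSpace X]

/-- The exponents `d` admissible in the definition of the upper Phi-dimension. -/
def upperExponents (Φ : ℝ → ℝ) (μ : Measure X) : Set ℝ :=
  {d | ∃ C₁ > 0, ∃ C₂ > 0, ∀ r R : ℝ, 0 < r → 0 < R → R < 1 → R ≤ C₁ → r < R ^ (1 + Φ R) →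
    ∀ x ∈ μ.support,
      μ.real (Metric.ball x R) / μ.real (Metric.ball x r) ≤ C₂ * (R / r) ^ d}

/-- The exponents `d` admissible in the definition of the lower Phi-dimension. -/
def lowerExponents (Φ : ℝ → ℝ) (μ : Measure X) : Set ℝ :=
  {d | ∃ C₁ > 0, ∃ C₂ > 0, ∀ r R : ℝ, 0 < r → 0 < R → R < 1 → R ≤ C₁ → r < R ^ (1 + Φ R) →
    ∀ x ∈ μ.support,
      C₂ * (R / r) ^ d ≤ μ.real (Metric.ball x R) / μ.real (Metric.ball x r)}

/-- The upper Phi-dimension, an extended real (`⊤` if no exponent is admissible). -/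
def upperDim (Φ : ℝ → ℝ) (μ : Measure X) : EReal :=
  ⨅ d ∈ upperExponents Φ μ, (d : EReal)

/-- The lower Phi-dimension, an extended real. -/
def lowerDim (Φ : ℝ → ℝ) (μ : Measure X) : EReal :=
  ⨆ d ∈ lowerExponents Φ μ, (d : EReal)

end Dimensions

/-! ### Separated families of similar copies -/

section Separation

variable {E : Type*} [PseudoMetricSpace E]

/-- `J` is an `r`-similarity of `I`: a subset of `I` that is the image of `I` under a similarity
with contraction factor `r`. -/
def IsSimilarCopy (r : ℝ) (I J : Set E) : Prop :=
  J ⊆ I ∧ ∃ S : E → E, (∀ x y, dist (S x) (S y) = r * dist x y) ∧ J = S '' I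

/-- A family of `r`-similarities of `I` that is `τ`-separated: distinct members are at distance
at least `τ * r * diam I`. -/
def IsSeparatedFamily (I : Set E) (r τ : ℝ) {t : ℕ} (J : Fin t → Set E) : Prop :=
  (∀ i, IsSimilarCopy r I (J i)) ∧
    ∀ i j, i ≠ j → ∀ x ∈ J i, ∀ y ∈ J j, τ * r * Metric.diam I ≤ dist x y

/-- The `(t, r, τ)`-separation property of `I`. -/
def HasSeparationProperty (I : Set E) (t : ℕ) (r τ : ℝ) : Prop :=
  ∃ J : Fin t → Set E, IsSeparatedFamily I r τ J

end Separation

/-! ### The probability space -/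

/-- Strictly positive probability vectors of length `t`. -/
def openSimplex (t : ℕ) : Set (Fin t → ℝ) := {p | (∀ i, 0 < p i) ∧ ∑ i, p i = 1}

/-- The space of parameters of one step: the disjoint union over `t ≥ 2` of
`(0, ρ t] × openSimplex t`, with its Borel sigma-algebra. -/
abbrev StepSpace (ρ : ℕ → ℝ) : Type :=
  Σ t : {t : ℕ // 2 ≤ t}, Ioc (0 : ℝ) (ρ t) × openSimplex t

/-- Sequences of step parameters; `ω n` holds the parameters used to pass from step `n` to step
`n + 1`, so that the first step is governed by `ω 0`. -/
abbrev SampleSpace (ρ : ℕ → ℝ) : Type := ℕ → StepSpace ρ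

section RandomVariables

variable {ρ : ℕ → ℝ}

/-- The number of children. -/
def numChildren (a : StepSpace ρ) : ℕ := a.1

/-- The ratio of the diameter of a child to that of its parent. -/
def ratio (a : StepSpace ρ) : ℝ := a.2.1

/-- The probabilities of the children. -/
def prob (a : StepSpace ρ) : Fin (numChildren a) → ℝ := a.2.2.1

/-- The largest of the probabilities. -/
def maxProb (a : StepSpace ρ) : ℝ := ⨆ i, prob a i

/-- The smallest of the probabilities. -/
def minProb (a : StepSpace ρ) : ℝ := ⨅ i, prob a i

/-- The law of an independent sequence of steps, each with law `π`. -/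
def sampleMeasure (π : Measure (StepSpace ρ)) [IsProbabilityMeasure π] :
    Measure (SampleSpace ρ) :=
  Measure.infinitePi fun _ : ℕ => π

/-- `α = ess sup (log m₁ / log r₁)`, an extended real. -/
def alpha (π : Measure (StepSpace ρ)) [IsProbabilityMeasure π] : EReal :=
  essSup (fun ω : SampleSpace ρ =>
    ((Real.log (minProb (ω 0)) / Real.log (ratio (ω 0)) : ℝ) : EReal)) (sampleMeasure π)

/-- `β = ess inf (log M₁ / log r₁)`, an extended real. -/
def beta (π : Measure (StepSpace ρ)) [IsProbabilityMeasure π] : EReal :=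
  essInf (fun ω : SampleSpace ρ =>
    ((Real.log (maxProb (ω 0)) / Real.log (ratio (ω 0)) : ℝ) : EReal)) (sampleMeasure π)

/-! ### Moran sets and Moran measures -/

/-- Addresses of the Moran sets of step `n`: the children of `w` are the `(w, i)`. -/
def Word (ω : SampleSpace ρ) : ℕ → Type
  | 0 => Unit
  | n + 1 => Word ω n × Fin (numChildren (ω n))

/-- Infinite addresses. -/
abbrev Branch (ω : SampleSpace ρ) : Type := ∀ n, Fin (numChildren (ω n))

/-- The first `n` letters of an infinite address. -/
def initialWord {ω : SampleSpace ρ} (x : Branch ω) : ∀ n, Word ω n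
  | 0 => ()
  | n + 1 => (initialWord x n, x n)

/-- The product of the probabilities along an address. -/
def wordWeight {ω : SampleSpace ρ} : ∀ n, Word ω n → ℝ
  | 0, _ => 1
  | n + 1, w => wordWeight n w.1 * prob (ω n) w.2

/-- A choice, for the sequence of parameters `ω`, of all the Moran sets of all steps: step `0` is
`I₀`, and the children of each step-`n` set form a `τ`-separated family of `T_{n+1}(ω)` many
`r_{n+1}(ω)`-similarities of it. -/
structure MoranConstruction {E : Type*} [PseudoMetricSpace E] (I₀ : Set E) (τ : ℝ)
    (ω : SampleSpace ρ) where
  cell : ∀ n, Word ω n → Set E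
  cell_zero : cell 0 () = I₀
  children : ∀ n (w : Word ω n),
    IsSeparatedFamily (cell n w) (ratio (ω n)) τ
      (fun i : Fin (numChildren (ω n)) => cell (n + 1) (w, i))

/-- The measure on the children of a step, given by their probabilities. -/
def childMeasure (a : StepSpace ρ) : Measure (Fin (numChildren a)) :=
  ∑ i, ENNReal.ofReal (prob a i) • Measure.dirac i

lemma prob_pos (a : StepSpace ρ) (i : Fin (numChildren a)) : 0 < prob a i := a.2.2.2.1 i

lemma sum_prob (a : StepSpace ρ) : ∑ i, prob a i = 1 := a.2.2.2.2

lemma ratio_pos (a : StepSpace ρ) : 0 < ratio a := a.2.1.2.1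

instance (a : StepSpace ρ) : IsProbabilityMeasure (childMeasure a) := by
  constructor
  simp only [childMeasure, Measure.finsetSum_apply, Measure.smul_apply, measure_univ,
    smul_eq_mul, mul_one]
  rw [← ENNReal.ofReal_sum_of_nonneg (fun i _ => (prob_pos a i).le), sum_prob, ENNReal.ofReal_one]

lemma childMeasure_singleton (a : StepSpace ρ) (i : Fin (numChildren a)) :
    childMeasure a {i} = ENNReal.ofReal (prob a i) := by
  simp [childMeasure, Measure.finsetSum_apply, Set.indicator_apply]

namespace MoranConstruction

section Metric

variable {E : Type*} [MetricSpace E] {I₀ : Set E} {τ : ℝ} {ω : SampleSpace ρ}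

/-- The point with a given infinite address. -/
def coding [Nonempty E] (K : MoranConstruction I₀ τ ω) (x : Branch ω) : E :=
  Classical.epsilon fun y => ∀ n, y ∈ K.cell n (initialWord x n)

/-- The random Moran measure: the image under the coding map of the product of the probability
vectors. It gives each Moran set the product of the probabilities along its address
(`moranMeasure_cell`), that is, `μ (I₀) = 1` and `μ (I^(j)) = μ (I) * p_{n+1}^(j)` for the
children `I^(j)` of a step-`n` set `I`. -/
def moranMeasure [Nonempty E] [MeasurableSpace E] (K : MoranConstruction I₀ τ ω) : Measure E :=
  (Measure.infinitePi fun n => childMeasure (ω n)).map K.coding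

end Metric

section Facts

variable {E : Type*} [MetricSpace E] {I₀ : Set E} {τ : ℝ} {ω : SampleSpace ρ}

lemma cell_child_subset (K : MoranConstruction I₀ τ ω) (n : ℕ) (w : Word ω n)
    (i : Fin (numChildren (ω n))) : K.cell (n + 1) (w, i) ⊆ K.cell n w :=
  ((K.children n w).1 i).1

lemma cell_isCompact (K : MoranConstruction I₀ τ ω) (hI : IsCompact I₀) :
    ∀ n (w : Word ω n), IsCompact (K.cell n w)
  | 0, () => by rw [K.cell_zero]; exact hI
  | n + 1, (w, i) => by
    obtain ⟨-, S, hS, h⟩ := (K.children n w).1 i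
    have hL : LipschitzWith (ratio (ω n)).toNNReal S := LipschitzWith.of_dist_le_mul fun x y => by
      rw [hS, Real.coe_toNNReal _ (ratio_pos _).le]
    rw [show K.cell (n + 1) (w, i) = S '' K.cell n w from h]
    exact (cell_isCompact K hI n w).image hL.continuous

lemma cell_nonempty (K : MoranConstruction I₀ τ ω) (hI : I₀.Nonempty) :
    ∀ n (w : Word ω n), (K.cell n w).Nonempty
  | 0, () => by rw [K.cell_zero]; exact hI
  | n + 1, (w, i) => by
    obtain ⟨-, S, hS, h⟩ := (K.children n w).1 i
    rw [show K.cell (n + 1) (w, i) = S '' K.cell n w from h]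
    exact (cell_nonempty K hI n w).image S

lemma coding_mem [Nonempty E] (K : MoranConstruction I₀ τ ω) (hI : IsCompact I₀)
    (hne : I₀.Nonempty)
    (x : Branch ω) (n : ℕ) : K.coding x ∈ K.cell n (initialWord x n) := by
  have h : ∃ y, ∀ n, y ∈ K.cell n (initialWord x n) := by
    obtain ⟨y, hy⟩ := IsCompact.nonempty_iInter_of_sequence_nonempty_isCompact_isClosed
      (fun n => K.cell n (initialWord x n)) (fun n => K.cell_child_subset n _ _)
      (fun n => K.cell_nonempty hne n _) (K.cell_isCompact hI 0 _)
      (fun n => (K.cell_isCompact hI n _).isClosed)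
    exact ⟨y, fun n => Set.mem_iInter.1 hy n⟩
  exact Classical.epsilon_spec h n

lemma diam_cell (K : MoranConstruction I₀ τ ω) :
    ∀ n (w : Word ω n),
      Metric.diam (K.cell n w) = (∏ k ∈ Finset.range n, ratio (ω k)) * Metric.diam I₀
  | 0, () => by rw [K.cell_zero]; simp
  | n + 1, (w, i) => by
    obtain ⟨-, S, hS, h⟩ := (K.children n w).1 i
    have hd : Metric.diam (S '' K.cell n w) = ratio (ω n) * Metric.diam (K.cell n w) := by
      have hc : ((ratio (ω n)).toNNReal : ℝ) = ratio (ω n) :=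
        Real.coe_toNNReal _ (ratio_pos _).le
      have he : ∀ x y, edist (S x) (S y) = ((ratio (ω n)).toNNReal : ENNReal) * edist x y := by
        intro x y
        rw [edist_dist, hS, ENNReal.ofReal_mul (ratio_pos _).le, edist_dist]; rfl
      let f : E →ᵈ E := ⟨S, (ratio (ω n)).toNNReal,
        (Real.toNNReal_pos.2 (ratio_pos _)).ne', he⟩
      have hE : Metric.ediam (S '' K.cell n w)
          = ((ratio (ω n)).toNNReal : ENNReal) * Metric.ediam (K.cell n w) := by
        apply le_antisymm
        · apply Metric.ediam_le
          rintro _ ⟨x, hx, rfl⟩ _ ⟨y, hy, rfl⟩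
          rw [he]
          gcongr
          exact Metric.edist_le_ediam_of_mem hx hy
        · have hpos : ((ratio (ω n)).toNNReal : ENNReal) ≠ 0 := by
            simpa using ratio_pos (ω n)
          rw [mul_comm, ← ENNReal.le_div_iff_mul_le (Or.inl hpos) (Or.inl ENNReal.coe_ne_top)]
          apply Metric.ediam_le
          intro x hx y hy
          rw [ENNReal.le_div_iff_mul_le (Or.inl hpos) (Or.inl ENNReal.coe_ne_top), mul_comm, ← he]
          exact Metric.edist_le_ediam_of_mem (Set.mem_image_of_mem S hx) (Set.mem_image_of_mem S hy)
      rw [Metric.diam, hE, ENNReal.toReal_mul, Metric.diam, ENNReal.coe_toReal, hc]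
    rw [show K.cell (n + 1) (w, i) = S '' K.cell n w from h, hd, diam_cell K n w,
      Finset.prod_range_succ]
    ring

lemma cell_disjoint (K : MoranConstruction I₀ τ ω) (hτ : 0 < τ) (hd : 0 < Metric.diam I₀) :
    ∀ n (v w : Word ω n), v ≠ w → Disjoint (K.cell n v) (K.cell n w)
  | 0, _, _, h => absurd rfl h
  | n + 1, (v, i), (w, j), h => by
    by_cases hvw : v = w
    · subst hvw
      have hij : i ≠ j := fun e => h (by rw [e])
      rw [Set.disjoint_left]
      intro x hx hy
      have hle := (K.children n v).2 i j hij x hx x hy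
      rw [dist_self, diam_cell] at hle
      have : 0 < τ * ratio (ω n) *
          ((∏ k ∈ Finset.range n, ratio (ω k)) * Metric.diam I₀) :=
        mul_pos (mul_pos hτ (ratio_pos _))
          (mul_pos (Finset.prod_pos fun k _ => ratio_pos _) hd)
      linarith
    · exact (cell_disjoint K hτ hd n v w hvw).mono (K.cell_child_subset n v i)
        (K.cell_child_subset n w j)

lemma coding_preimage_cell [Nonempty E] (K : MoranConstruction I₀ τ ω) (hI : IsCompact I₀)
    (hτ : 0 < τ) (hd : 0 < Metric.diam I₀) (n : ℕ) (w : Word ω n) :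
    K.coding ⁻¹' K.cell n w = {x | initialWord x n = w} := by
  have hne : I₀.Nonempty := by
    rw [Set.nonempty_iff_ne_empty]
    rintro rfl
    simp at hd
  ext x
  constructor
  · intro hx
    by_contra hne'
    exact Set.disjoint_left.1 (K.cell_disjoint hτ hd n _ _ hne') (K.coding_mem hI hne x n) hx
  · intro hx
    have hx' : initialWord x n = w := hx
    subst hx'
    exact K.coding_mem hI hne x n

lemma eventually_initialWord_eq (x : Branch ω) (n : ℕ) :
    ∀ᶠ y in 𝓝 x, initialWord y n = initialWord x n := by
  induction n with
  | zero => exact Eventually.of_forall fun _ => rfl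
  | succ n ih =>
    have h : ∀ᶠ y in 𝓝 x, y n = x n := by
      have hc : Continuous fun y : Branch ω => y n := continuous_apply n
      exact hc.continuousAt.eventually ((isOpen_discrete ({x n} : Set _)).mem_nhds rfl)
    filter_upwards [ih, h] with y h₁ h₂
    change (initialWord y n, y n) = (initialWord x n, x n)
    rw [h₁, h₂]

/-- The coding map is continuous, so that the Moran measure is a genuine push-forward. -/
lemma continuous_coding [Nonempty E] (K : MoranConstruction I₀ τ ω) (hI : IsCompact I₀)
    (hne : I₀.Nonempty)
    (hr : ∀ n, ratio (ω n) ≤ 1 / 2) : Continuous K.coding := by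
  rw [continuous_iff_continuousAt]
  intro x
  rw [ContinuousAt, Metric.tendsto_nhds]
  intro ε hε
  have hlim : Tendsto (fun n : ℕ => (1 / 2 : ℝ) ^ n * Metric.diam I₀) atTop
      (𝓝 (0 * Metric.diam I₀)) :=
    (tendsto_pow_atTop_nhds_zero_of_lt_one (by norm_num) (by norm_num)).mul_const _
  rw [zero_mul] at hlim
  obtain ⟨n, hn⟩ := (hlim.eventually_lt_const hε).exists
  filter_upwards [eventually_initialWord_eq x n] with y hy
  have h₁ := K.coding_mem hI hne x n
  have h₂ := K.coding_mem hI hne y n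
  rw [hy] at h₂
  refine (Metric.dist_le_diam_of_mem (K.cell_isCompact hI n _).isBounded h₂ h₁).trans_lt ?_
  rw [diam_cell]
  refine lt_of_le_of_lt ?_ hn
  gcongr
  calc ∏ k ∈ Finset.range n, ratio (ω k) ≤ ∏ _k ∈ Finset.range n, (1 / 2 : ℝ) :=
        Finset.prod_le_prod (fun k _ => (ratio_pos _).le) fun k _ => hr k
    _ = (1 / 2 : ℝ) ^ n := by simp

/-- Cylinder sets have the prescribed mass. -/
lemma infinitePi_initialWord (n : ℕ) (w : Word ω n) :
    (Measure.infinitePi fun n => childMeasure (ω n)) {x : Branch ω | initialWord x n = w}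
      = ENNReal.ofReal (wordWeight n w) := by
  have key : ∀ n (w : Word ω n), ∃ t : ∀ k, Set (Fin (numChildren (ω k))),
      {x : Branch ω | initialWord x n = w} = Set.pi (Finset.range n) t ∧
      ∏ k ∈ Finset.range n, childMeasure (ω k) (t k) = ENNReal.ofReal (wordWeight n w) ∧
      0 ≤ wordWeight n w := by
    intro n
    induction n with
    | zero =>
      intro w
      refine ⟨fun _ => Set.univ, ?_, by simp [wordWeight], by simp [wordWeight]⟩
      ext x
      simp only [Set.mem_ofPred_eq, Finset.range_zero, Finset.coe_empty, Set.empty_pi,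
        Set.mem_univ, iff_true]
      rfl
    | succ n ih =>
      rintro ⟨w, i⟩
      obtain ⟨t, ht, hp, h0⟩ := ih w
      refine ⟨Function.update t n {i}, ?_, ?_, mul_nonneg h0 (prob_pos _ _).le⟩
      · ext x
        have hx : initialWord x n = w ↔ ∀ k ∈ Finset.range n, x k ∈ t k := by
          have := Set.ext_iff.1 ht x
          simpa [Set.mem_pi] using this
        have hs : initialWord x (n + 1) = (w, i) ↔ initialWord x n = w ∧ x n = i :=
          Prod.ext_iff
        simp only [Set.mem_ofPred_eq, hs, hx, Set.mem_pi, Finset.mem_coe, Finset.mem_range]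
        constructor
        · rintro ⟨h₁, h₂⟩ k hk
          rcases Nat.lt_succ_iff_lt_or_eq.1 hk with hk' | rfl
          · rw [Function.update_of_ne hk'.ne]
            exact h₁ k hk'
          · simpa using h₂
        · intro h
          refine ⟨fun k hk => ?_, by simpa using h n (Nat.lt_succ_self n)⟩
          have := h k (hk.trans (Nat.lt_succ_self n))
          rwa [Function.update_of_ne hk.ne] at this
      · rw [Finset.prod_range_succ, Function.update_self, childMeasure_singleton]
        have : ∏ k ∈ Finset.range n, childMeasure (ω k) (Function.update t n {i} k)
            = ∏ k ∈ Finset.range n, childMeasure (ω k) (t k) :=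
          Finset.prod_congr rfl fun k hk => by
            rw [Function.update_of_ne (Finset.mem_range.1 hk).ne]
        rw [this, hp, ← ENNReal.ofReal_mul h0]
        rfl
  obtain ⟨t, ht, hp, -⟩ := key n w
  rw [ht, Measure.infinitePi_pi _ (fun k _ => MeasurableSet.of_discrete), hp]

/-- The Moran measure gives each Moran set the product of the probabilities along its address. -/
theorem moranMeasure_cell [Nonempty E] [MeasurableSpace E] [BorelSpace E]
    (K : MoranConstruction I₀ τ ω)
    (hI : IsCompact I₀) (hτ : 0 < τ) (hd : 0 < Metric.diam I₀)
    (hr : ∀ n, ratio (ω n) ≤ 1 / 2) (n : ℕ) (w : Word ω n) :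
    K.moranMeasure (K.cell n w) = ENNReal.ofReal (wordWeight n w) := by
  have hne : I₀.Nonempty := by
    rw [Set.nonempty_iff_ne_empty]
    rintro rfl
    simp at hd
  rw [moranMeasure, Measure.map_apply (K.continuous_coding hI hne hr).measurable
    (K.cell_isCompact hI n w).isClosed.measurableSet, K.coding_preimage_cell hI hτ hd,
    infinitePi_initialWord]

end Facts


end MoranConstruction

end RandomVariables

end RandomMoran

end

/-! All cells of step `n` have diameter `scale ω n`, and distinct ones are at least `τ * scale ω n`
apart. So a ball about a coded point lies in the cell of one step up to null sets and contains the
cell of a slightly later step. A quotient of ball masses is thereby compared with the product of the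
probabilities that the branch meets between two scales. This reduces the theorem to comparing each
probability with a power of the ratio of its step.

Bounds for all dimension functions: almost surely every step satisfies `maxProb ≤ ratio ^ β` and
`ratio ^ α ≤ minProb` (for finite exponents), and these inequalities multiply along a branch.
Rounding a radius to a scale costs one step at either end. The essential infimum hypotheses bound
that cost by a constant (`mem_lowerExponents`, `mem_upperExponents`).

Sharpness for small `Φ`: if `q > β`, a step with `ratio ^ q ≤ maxProb` has positive probability. The
blocks of length `Nat.log b j` starting at `j ^ 2` are disjoint, and for suitable `b` such a block
consists of these steps with probability at least `1 / (j + 1)`. By the second Borel-Cantelli lemma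
this happens infinitely often (`ae_frequently_run`). By the law of large numbers `|log R|` is at
most of order `j ^ 2` at the start of the block, so smallness makes `Φ R * |log R|` negligible
against `log j`, whereas the block shrinks the scale by at least `2 ^ Nat.log b j`. The two ends of
the block are thus admissible radii (`eventually_mul_scale_lt_rpow`), and the branch of largest
children rules out every exponent above `q`. The case of `α` is the same with smallest children. -/

namespace RandomMoran

/-! ### Scales and the weights of branches. -/

section Scale

variable {ρ : ℕ → ℝ}

/-- The common diameter of the Moran sets of step `n`, relative to the initial set. -/
noncomputable def scale (ω : SampleSpace ρ) (n : ℕ) : ℝ := ∏ k ∈ Finset.range n, ratio (ω k)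

/-- The product of the first `n` probabilities along an infinite address. -/
noncomputable def branchWeight {ω : SampleSpace ρ} (y : Branch ω) (n : ℕ) : ℝ :=
  ∏ k ∈ Finset.range n, prob (ω k) (y k)

lemma scale_zero (ω : SampleSpace ρ) : scale ω 0 = 1 := by simp [scale]

lemma scale_succ (ω : SampleSpace ρ) (n : ℕ) : scale ω (n + 1) = scale ω n * ratio (ω n) :=
  Finset.prod_range_succ _ _

lemma scale_pos (ω : SampleSpace ρ) (n : ℕ) : 0 < scale ω n :=
  Finset.prod_pos fun _ _ => ratio_pos _

lemma branchWeight_zero {ω : SampleSpace ρ} (y : Branch ω) : branchWeight y 0 = 1 := by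
  simp [branchWeight]

lemma branchWeight_succ {ω : SampleSpace ρ} (y : Branch ω) (n : ℕ) :
    branchWeight y (n + 1) = branchWeight y n * prob (ω n) (y n) :=
  Finset.prod_range_succ _ _

lemma branchWeight_pos {ω : SampleSpace ρ} (y : Branch ω) (n : ℕ) : 0 < branchWeight y n :=
  Finset.prod_pos fun _ _ => prob_pos _ _

lemma wordWeight_initialWord {ω : SampleSpace ρ} (y : Branch ω) :
    ∀ n, wordWeight n (initialWord y n) = branchWeight y n
  | 0 => by rw [branchWeight_zero]; rfl
  | n + 1 => by
    rw [branchWeight_succ, ← wordWeight_initialWord y n]; rfl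

lemma prob_le_one (a : StepSpace ρ) (i : Fin (numChildren a)) : prob a i ≤ 1 := by
  rw [← sum_prob a]
  exact Finset.single_le_sum (fun j _ => (prob_pos a j).le) (Finset.mem_univ i)

lemma branchWeight_antitone {ω : SampleSpace ρ} (y : Branch ω) : Antitone (branchWeight y) :=
  antitone_nat_of_succ_le fun n => by
    rw [branchWeight_succ]
    exact mul_le_of_le_one_right (branchWeight_pos y n).le (prob_le_one _ _)

instance (a : StepSpace ρ) : Nonempty (Fin (numChildren a)) :=
  ⟨⟨0, lt_of_lt_of_le two_pos a.1.2⟩⟩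

lemma exists_prob_eq_maxProb (a : StepSpace ρ) : ∃ i, prob a i = maxProb a :=
  exists_eq_ciSup_of_finite

lemma exists_prob_eq_minProb (a : StepSpace ρ) : ∃ i, prob a i = minProb a :=
  exists_eq_ciInf_of_finite

lemma prob_le_maxProb (a : StepSpace ρ) (i : Fin (numChildren a)) : prob a i ≤ maxProb a :=
  le_ciSup (finite_range (prob a)).bddAbove i

lemma minProb_le_prob (a : StepSpace ρ) (i : Fin (numChildren a)) : minProb a ≤ prob a i :=
  ciInf_le (finite_range (prob a)).bddBelow i

lemma minProb_pos (a : StepSpace ρ) : 0 < minProb a := by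
  obtain ⟨i, hi⟩ := exists_prob_eq_minProb a
  exact hi ▸ prob_pos a i

lemma maxProb_pos (a : StepSpace ρ) : 0 < maxProb a := by
  obtain ⟨i, hi⟩ := exists_prob_eq_maxProb a
  exact hi ▸ prob_pos a i

lemma minProb_le_one (a : StepSpace ρ) : minProb a ≤ 1 := by
  obtain ⟨i, hi⟩ := exists_prob_eq_minProb a
  exact hi ▸ prob_le_one a i

variable {ω : SampleSpace ρ}

lemma scale_antitone (hr : ∀ n, ratio (ω n) ≤ 1 / 2) : Antitone (scale ω) :=
  antitone_nat_of_succ_le fun n => by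
    rw [scale_succ]
    exact mul_le_of_le_one_right (scale_pos ω n).le ((hr n).trans (by norm_num))

lemma scale_add_le (hr : ∀ n, ratio (ω n) ≤ 1 / 2) (n l : ℕ) :
    scale ω (n + l) ≤ scale ω n * (1 / 2) ^ l := by
  induction l with
  | zero => simp
  | succ l ih =>
    rw [← add_assoc, scale_succ, pow_succ, ← mul_assoc]
    exact mul_le_mul ih (hr _) (ratio_pos _).le (by have := scale_pos ω n; positivity)

lemma tendsto_scale (hr : ∀ n, ratio (ω n) ≤ 1 / 2) : Tendsto (scale ω) atTop (𝓝 0) := by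
  refine squeeze_zero (fun n => (scale_pos ω n).le) (fun n => ?_)
    (tendsto_pow_atTop_nhds_zero_of_lt_one (r := (1 / 2 : ℝ)) (by norm_num) (by norm_num))
  simpa [scale_zero] using scale_add_le hr 0 n

lemma exists_scale_lt_le (hr : ∀ n, ratio (ω n) ≤ 1 / 2) {s : ℝ} (hs : 0 < s) (hs1 : s ≤ 1) :
    ∃ n, scale ω (n + 1) < s ∧ s ≤ scale ω n := by
  classical
  have h : ∃ n, scale ω n < s := ((tendsto_scale hr).eventually_lt_const hs).exists
  obtain ⟨m, hm⟩ : ∃ m, Nat.find h = m + 1 := by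
    refine Nat.exists_eq_succ_of_ne_zero fun h0 => ?_
    have := Nat.find_spec h
    rw [h0, scale_zero] at this
    exact absurd this (not_lt.2 hs1)
  exact ⟨m, hm ▸ Nat.find_spec h, not_lt.1 (Nat.find_min h (by omega))⟩

end Scale

/-! ### Masses of balls centred at coded points. -/

namespace MoranConstruction

variable {ρ : ℕ → ℝ} {E : Type*} [MetricSpace E] {I₀ : Set E} {τ : ℝ} {ω : SampleSpace ρ}

lemma nonempty_of_diam (hd : Metric.diam I₀ = 1) : I₀.Nonempty := by
  rw [nonempty_iff_ne_empty]
  rintro rfl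
  simp at hd

/-- Siblings are separated by `τ` times their own diameter. Words that parted at an earlier step
inherit the larger gap of that step, since the scales decrease. -/
lemma le_dist_of_ne (K : MoranConstruction I₀ τ ω) (hτ : 0 < τ) (hd : Metric.diam I₀ = 1)
    (hr : ∀ n, ratio (ω n) ≤ 1 / 2) :
    ∀ n (v w : Word ω n), v ≠ w → ∀ x ∈ K.cell n v, ∀ y ∈ K.cell n w, τ * scale ω n ≤ dist x y
  | 0, _, _, h => absurd rfl h
  | n + 1, (v, i), (w, j), h => by
    intro x hx y hy
    by_cases hvw : v = w
    · subst hvw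
      have hij : i ≠ j := fun e => h (by rw [e])
      have hle := (K.children n v).2 i j hij x hx y hy
      rw [diam_cell, hd, mul_one, mul_assoc, mul_comm (ratio _)] at hle
      rwa [scale_succ]
    · refine le_trans ?_ (le_dist_of_ne K hτ hd hr n v w hvw x (K.cell_child_subset n v i hx) y
        (K.cell_child_subset n w j hy))
      exact mul_le_mul_of_nonneg_left (scale_antitone hr n.le_succ) hτ.le

variable [Nonempty E] [MeasurableSpace E] [BorelSpace E]

lemma isProbabilityMeasure_moranMeasure (K : MoranConstruction I₀ τ ω) (hI : IsCompact I₀)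
    (hd : Metric.diam I₀ = 1) (hr : ∀ n, ratio (ω n) ≤ 1 / 2) :
    IsProbabilityMeasure K.moranMeasure :=
  Measure.isProbabilityMeasure_map
    (K.continuous_coding hI (nonempty_of_diam hd) hr).measurable.aemeasurable

/-- A ball larger than the Moran set around its centre has at least its mass. -/
lemma branchWeight_le_ball (K : MoranConstruction I₀ τ ω) (hI : IsCompact I₀) (hτ : 0 < τ)
    (hd : Metric.diam I₀ = 1) (hr : ∀ n, ratio (ω n) ≤ 1 / 2) (y : Branch ω) {n : ℕ} {s : ℝ}
    (hs : scale ω n < s) : branchWeight y n ≤ K.moranMeasure.real (Metric.ball (K.coding y) s) := by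
  have := K.isProbabilityMeasure_moranMeasure hI hd hr
  have hsub : K.cell n (initialWord y n) ⊆ Metric.ball (K.coding y) s := by
    intro z hz
    rw [Metric.mem_ball]
    refine lt_of_le_of_lt ?_ hs
    have h := Metric.dist_le_diam_of_mem (K.cell_isCompact hI n _).isBounded hz
      (K.coding_mem hI (nonempty_of_diam hd) y n)
    rwa [diam_cell, hd, mul_one] at h
  refine le_trans (le_of_eq ?_) (measureReal_mono hsub)
  rw [measureReal_def, K.moranMeasure_cell hI hτ (by rw [hd]; exact one_pos) hr,
    wordWeight_initialWord, ENNReal.toReal_ofReal (branchWeight_pos y n).le]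

/-- A ball smaller than the gaps between Moran sets has at most the mass of one of them. -/
lemma ball_le_branchWeight (K : MoranConstruction I₀ τ ω) (hI : IsCompact I₀) (hτ : 0 < τ)
    (hd : Metric.diam I₀ = 1) (hr : ∀ n, ratio (ω n) ≤ 1 / 2) (y : Branch ω) {n : ℕ} {s : ℝ}
    (hs : s ≤ τ * scale ω n) :
    K.moranMeasure.real (Metric.ball (K.coding y) s) ≤ branchWeight y n := by
  have hne := nonempty_of_diam hd
  -- The ball may meet other cells in points outside the coded set, so the inclusion is stated for
  -- addresses.
  have hsub : K.coding ⁻¹' Metric.ball (K.coding y) s ⊆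
      {x : Branch ω | initialWord x n = initialWord y n} := by
    intro z hz
    by_contra hzy
    have h := K.le_dist_of_ne hτ hd hr n _ _ hzy _ (K.coding_mem hI hne z n) _
      (K.coding_mem hI hne y n)
    rw [mem_preimage, Metric.mem_ball] at hz
    linarith
  rw [measureReal_def, moranMeasure, Measure.map_apply (K.continuous_coding hI hne hr).measurable
    Metric.isOpen_ball.measurableSet]
  refine ENNReal.toReal_le_of_le_ofReal (branchWeight_pos y n).le ((measure_mono hsub).trans ?_)
  rw [infinitePi_initialWord, wordWeight_initialWord]

lemma ball_real_pos (K : MoranConstruction I₀ τ ω) (hI : IsCompact I₀) (hτ : 0 < τ)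
    (hd : Metric.diam I₀ = 1) (hr : ∀ n, ratio (ω n) ≤ 1 / 2) (y : Branch ω) {s : ℝ}
    (hs : 0 < s) : 0 < K.moranMeasure.real (Metric.ball (K.coding y) s) := by
  obtain ⟨n, hn⟩ := ((tendsto_scale hr).eventually_lt_const hs).exists
  exact (branchWeight_pos y n).trans_le (K.branchWeight_le_ball hI hτ hd hr y hn)

lemma coding_mem_support (K : MoranConstruction I₀ τ ω) (hI : IsCompact I₀) (hτ : 0 < τ)
    (hd : Metric.diam I₀ = 1) (hr : ∀ n, ratio (ω n) ≤ 1 / 2) (y : Branch ω) :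
    K.coding y ∈ K.moranMeasure.support := by
  rw [Measure.mem_support_iff_forall]
  intro U hU
  obtain ⟨s, hs, hsU⟩ := Metric.mem_nhds_iff.1 hU
  refine lt_of_lt_of_le ?_ (measure_mono hsU)
  have := K.ball_real_pos hI hτ hd hr y hs
  rw [measureReal_def] at this
  exact (ENNReal.toReal_pos_iff.1 this).1

/-- The range of the coding map is compact, hence a closed set of full measure, and so contains the
support. Upper and lower bounds therefore need checking at coded points only. -/
lemma exists_coding_eq (K : MoranConstruction I₀ τ ω) (hI : IsCompact I₀)
    (hd : Metric.diam I₀ = 1) (hr : ∀ n, ratio (ω n) ≤ 1 / 2) {x : E}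
    (hx : x ∈ K.moranMeasure.support) : ∃ y, K.coding y = x := by
  have hc := K.continuous_coding hI (nonempty_of_diam hd) hr
  have hcl : IsClosed (range K.coding) := (isCompact_range hc).isClosed
  refine Measure.support_subset_of_isClosed hcl ?_ hx
  rw [mem_ae_iff, moranMeasure, Measure.map_apply hc.measurable hcl.measurableSet.compl]
  rw [show K.coding ⁻¹' (range K.coding)ᶜ = ∅ by ext y; simp, measure_empty]

end MoranConstruction

end RandomMoran

/-! ### Exponents admissible for every dimension function. -/

namespace RandomMoran

lemma IsDimensionFunction.rpow_le_self {Φ : ℝ → ℝ} (hΦ : IsDimensionFunction Φ) {R : ℝ}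
    (h0 : 0 < R) (h1 : R < 1) : R ^ (1 + Φ R) ≤ R := by
  have h := Real.rpow_le_rpow_of_exponent_ge h0 h1.le (y := 1 + Φ R) (z := 1)
    (by linarith [hΦ.nonneg R ⟨h0, h1⟩])
  rwa [Real.rpow_one] at h

section Ratios

variable {ρ : ℕ → ℝ} {ω : SampleSpace ρ} (y : Branch ω) {n m : ℕ} {c : ℝ}

/-- The quotient of scales is the product of the ratios of the intermediate steps, so the stepwise
inequalities multiply. The exponent may have either sign. -/
lemma branchWeight_le_of_prob_le (hnm : n ≤ m)
    (h : ∀ k ∈ Ico n m, prob (ω k) (y k) ≤ ratio (ω k) ^ c) :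
    branchWeight y m ≤ branchWeight y n * (scale ω m / scale ω n) ^ c := by
  induction m, hnm using Nat.le_induction with
  | base => simp [(scale_pos ω n).ne']
  | succ m hm ih =>
    rw [branchWeight_succ, scale_succ, mul_div_right_comm,
      Real.mul_rpow (div_pos (scale_pos _ _) (scale_pos _ _)).le (ratio_pos _).le, ← mul_assoc]
    refine mul_le_mul (ih fun k hk => h k ⟨hk.1, hk.2.trans m.lt_succ_self⟩)
      (h m ⟨hm, m.lt_succ_self⟩) (prob_pos _ _).le ?_
    exact mul_nonneg (branchWeight_pos y n).le
      (Real.rpow_nonneg (div_pos (scale_pos _ _) (scale_pos _ _)).le _)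

lemma le_branchWeight_of_le_prob (hnm : n ≤ m)
    (h : ∀ k ∈ Ico n m, ratio (ω k) ^ c ≤ prob (ω k) (y k)) :
    branchWeight y n * (scale ω m / scale ω n) ^ c ≤ branchWeight y m := by
  induction m, hnm using Nat.le_induction with
  | base => simp [(scale_pos ω n).ne']
  | succ m hm ih =>
    rw [branchWeight_succ, scale_succ, mul_div_right_comm,
      Real.mul_rpow (div_pos (scale_pos _ _) (scale_pos _ _)).le (ratio_pos _).le, ← mul_assoc]
    exact mul_le_mul (ih fun k hk => h k ⟨hk.1, hk.2.trans m.lt_succ_self⟩)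
      (h m ⟨hm, m.lt_succ_self⟩) (Real.rpow_nonneg (ratio_pos _).le _) (branchWeight_pos y m).le

end Ratios

namespace MoranConstruction

variable {ρ : ℕ → ℝ} {E : Type*} [MetricSpace E] {I₀ : Set E} {τ : ℝ} {ω : SampleSpace ρ}
  [Nonempty E] [MeasurableSpace E] [BorelSpace E] {Φ : ℝ → ℝ}

lemma zero_mem_lowerExponents (K : MoranConstruction I₀ τ ω) (hI : IsCompact I₀) (hτ : 0 < τ)
    (hd : Metric.diam I₀ = 1) (hr : ∀ n, ratio (ω n) ≤ 1 / 2) (hΦ : IsDimensionFunction Φ) :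
    0 ∈ lowerExponents Φ K.moranMeasure := by
  have := K.isProbabilityMeasure_moranMeasure hI hd hr
  refine ⟨1, one_pos, 1, one_pos, fun r R hr0 hR0 hR1 _ hrR x hx => ?_⟩
  obtain ⟨y, rfl⟩ := K.exists_coding_eq hI hd hr hx
  rw [Real.rpow_zero, mul_one, le_div_iff₀ (K.ball_real_pos hI hτ hd hr y hr0), one_mul]
  exact measureReal_mono (Metric.ball_subset_ball (hrR.le.trans (hΦ.rpow_le_self hR0 hR1)))

lemma mem_lowerExponents (K : MoranConstruction I₀ τ ω) (hI : IsCompact I₀) (hτ : 0 < τ)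
    (hd : Metric.diam I₀ = 1) (hr : ∀ n, ratio (ω n) ≤ 1 / 2)
    (hΦ : IsDimensionFunction Φ) {b c : ℝ} (hb : 0 ≤ b) (hc : 0 < c)
    (hcr : ∀ n, c ≤ ratio (ω n)) (hM : ∀ n, maxProb (ω n) ≤ ratio (ω n) ^ b) :
    b ∈ lowerExponents Φ K.moranMeasure := by
  have := K.isProbabilityMeasure_moranMeasure hI hd hr
  -- `R ≤ τ` makes `r / τ ≤ 1`, so that it can be located among the scales. Rounding `R` down and
  -- `r` up to a scale costs a factor `c` each, and the gap constant costs `τ`.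
  refine ⟨τ, hτ, (τ * c ^ 2) ^ b, by positivity, fun r R hr0 hR0 hR1 hRτ hrR x hx => ?_⟩
  have hrR' : r < R := hrR.trans_le (hΦ.rpow_le_self hR0 hR1)
  obtain ⟨y, rfl⟩ := K.exists_coding_eq hI hd hr hx
  obtain ⟨n, hn1, hn2⟩ := exists_scale_lt_le hr hR0 hR1.le
  obtain ⟨m, hm1, hm2⟩ := exists_scale_lt_le hr (s := r / τ) (by positivity)
    ((div_le_one hτ).2 (hrR'.le.trans hRτ))
  rw [div_le_iff₀' hτ] at hm2
  rw [lt_div_iff₀' hτ] at hm1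
  have hpos := K.ball_real_pos hI hτ hd hr y hr0
  have hsn := scale_pos ω n
  have hsm := scale_pos ω m
  have hsn1 := scale_pos ω (n + 1)
  have hcm : c * scale ω m ≤ scale ω (m + 1) := by
    rw [scale_succ, mul_comm]; exact mul_le_mul_of_nonneg_left (hcr m) hsm.le
  have hcn : c * scale ω n ≤ scale ω (n + 1) := by
    rw [scale_succ, mul_comm]; exact mul_le_mul_of_nonneg_left (hcr n) hsn.le
  have hτcm : τ * (c * scale ω m) ≤ r := (mul_le_mul_of_nonneg_left hcm hτ.le).trans hm1.le
  have hc1 : c ≤ 1 := (hcr 0).trans ((hr 0).trans (by norm_num))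
  rw [← Real.mul_rpow (by positivity) (by positivity), le_div_iff₀ hpos]
  -- If `m ≤ n`, no full step lies between the radii. Then `R / r` is bounded, and monotonicity of
  -- the measure suffices.
  rcases le_or_gt m n with hmn | hmn
  · have hle : scale ω n ≤ scale ω m := scale_antitone hr hmn
    have h1 : (τ * c ^ 2 * (R / r)) ^ b ≤ 1 := by
      refine Real.rpow_le_one (by positivity) ?_ hb
      rw [← mul_div_assoc, div_le_one hr0]
      calc τ * c ^ 2 * R ≤ τ * c ^ 2 * scale ω m :=
            mul_le_mul_of_nonneg_left (hn2.trans hle) (by positivity)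
        _ = c * (τ * (c * scale ω m)) := by ring
        _ ≤ 1 * r := mul_le_mul hc1 hτcm (by positivity) zero_le_one
        _ = r := one_mul r
    exact (mul_le_of_le_one_left hpos.le h1).trans
      (measureReal_mono (Metric.ball_subset_ball hrR'.le))
  · have hw := branchWeight_le_of_prob_le y (c := b) (Nat.succ_le_of_lt hmn) fun k _ =>
      (prob_le_maxProb _ _).trans (hM k)
    have hq : (τ * c ^ 2 * (R / r)) ^ b ≤ (scale ω (n + 1) / scale ω m) ^ b := by
      refine Real.rpow_le_rpow (by positivity) ?_ hb
      rw [← mul_div_assoc, div_le_div_iff₀ hr0 hsm]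
      calc τ * c ^ 2 * R * scale ω m ≤ τ * c ^ 2 * scale ω n * scale ω m := by gcongr
        _ = (c * scale ω n) * (τ * (c * scale ω m)) := by ring
        _ ≤ scale ω (n + 1) * r := mul_le_mul hcn hτcm (by positivity) hsn1.le
    have hinv : (scale ω (n + 1) / scale ω m) ^ b * (scale ω m / scale ω (n + 1)) ^ b = 1 := by
      rw [← Real.mul_rpow (by positivity) (by positivity), div_mul_div_cancel₀ hsm.ne',
        div_self hsn1.ne', Real.one_rpow]
    calc _ ≤ (scale ω (n + 1) / scale ω m) ^ b * branchWeight y m :=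
          mul_le_mul hq (K.ball_le_branchWeight hI hτ hd hr y hm2) hpos.le (by positivity)
      _ ≤ (scale ω (n + 1) / scale ω m) ^ b *
          (branchWeight y (n + 1) * (scale ω m / scale ω (n + 1)) ^ b) :=
          mul_le_mul_of_nonneg_left hw (by positivity)
      _ = branchWeight y (n + 1) := by rw [mul_left_comm, hinv, mul_one]
      _ ≤ _ := K.branchWeight_le_ball hI hτ hd hr y hn1

lemma mem_upperExponents (K : MoranConstruction I₀ τ ω) (hI : IsCompact I₀) (hτ : 0 < τ)
    (hτ1 : τ < 1) (hd : Metric.diam I₀ = 1) (hr : ∀ n, ratio (ω n) ≤ 1 / 2)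
    (hΦ : IsDimensionFunction Φ) {a c : ℝ} (ha : 0 ≤ a) (hc : 0 < c)
    (hcm : ∀ n, c ≤ minProb (ω n)) (hm : ∀ n, ratio (ω n) ^ a ≤ minProb (ω n)) :
    a ∈ upperExponents Φ K.moranMeasure := by
  have := K.isProbabilityMeasure_moranMeasure hI hd hr
  have hc1 : c ≤ 1 := (hcm 0).trans (minProb_le_one _)
  -- Here the rounding is paid in mass: each of the steps `n` and `m` costs a factor `c`, a lower
  -- bound for the probabilities. The scales themselves compare with no loss but `τ`.
  refine ⟨τ, hτ, (c ^ 2)⁻¹ * (τ⁻¹) ^ a, by positivity, fun r R hr0 hR0 hR1 hRτ hrR x hx => ?_⟩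
  have hrR' : r < R := hrR.trans_le (hΦ.rpow_le_self hR0 hR1)
  obtain ⟨y, rfl⟩ := K.exists_coding_eq hI hd hr hx
  obtain ⟨n, hn1, hn2⟩ := exists_scale_lt_le hr (s := R / τ) (by positivity)
    ((div_le_one hτ).2 hRτ)
  obtain ⟨m, hm1, hm2⟩ := exists_scale_lt_le hr hr0 (hrR'.trans hR1).le
  rw [div_le_iff₀' hτ] at hn2
  rw [lt_div_iff₀' hτ] at hn1
  have hsn1 := scale_pos ω (n + 1)
  have hsm := scale_pos ω m
  have hbm := branchWeight_pos y m
  have hstep : ∀ k, c * branchWeight y k ≤ branchWeight y (k + 1) := fun k => by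
    rw [branchWeight_succ, mul_comm]
    exact mul_le_mul_of_nonneg_left ((hcm k).trans (minProb_le_prob _ _)) (branchWeight_pos y k).le
  have hlow := K.branchWeight_le_ball hI hτ hd hr y hm1
  have hupp := K.ball_le_branchWeight hI hτ hd hr y hn2
  rw [mul_assoc, ← Real.mul_rpow (by positivity) (by positivity),
    div_le_iff₀ (K.ball_real_pos hI hτ hd hr y hr0)]
  have hQ : (1 : ℝ) ≤ (τ⁻¹ * (R / r)) ^ a := by
    refine Real.one_le_rpow ?_ ha
    have h1 : 1 ≤ τ⁻¹ := (one_le_inv₀ hτ).2 hτ1.le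
    have h2 : 1 ≤ R / r := (one_le_div hr0).2 hrR'.le
    nlinarith
  have key : c ^ 2 * branchWeight y n ≤ (τ⁻¹ * (R / r)) ^ a * branchWeight y (m + 1) := by
    rcases le_or_gt m n with hmn | hmn
    · calc c ^ 2 * branchWeight y n = c * (c * branchWeight y n) := by ring
        _ ≤ 1 * branchWeight y (n + 1) :=
          mul_le_mul hc1 (hstep n) (mul_pos hc (branchWeight_pos y n)).le zero_le_one
        _ ≤ (τ⁻¹ * (R / r)) ^ a * branchWeight y (m + 1) :=
          mul_le_mul hQ (branchWeight_antitone y (by omega)) (branchWeight_pos y _).le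
            (zero_le_one.trans hQ)
    · have hw := le_branchWeight_of_le_prob y (c := a) (Nat.succ_le_of_lt hmn) fun k _ =>
        (hm k).trans (minProb_le_prob _ _)
      have hq : (scale ω (n + 1) / scale ω m) ^ a ≤ (τ⁻¹ * (R / r)) ^ a := by
        refine Real.rpow_le_rpow (by positivity) ?_ ha
        rw [← mul_div_assoc, inv_mul_eq_div, div_div, div_le_div_iff₀ hsm (by positivity)]
        calc scale ω (n + 1) * (τ * r) = (τ * scale ω (n + 1)) * r := by ring
          _ ≤ R * scale ω m := mul_le_mul hn1.le hm2 hr0.le hR0.le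
      have hinv : (scale ω (n + 1) / scale ω m) ^ a * (scale ω m / scale ω (n + 1)) ^ a = 1 := by
        rw [← Real.mul_rpow (by positivity) (by positivity), div_mul_div_cancel₀ hsm.ne',
          div_self hsn1.ne', Real.one_rpow]
      calc c ^ 2 * branchWeight y n = c * (c * branchWeight y n) := by ring
        _ ≤ c * branchWeight y (n + 1) := mul_le_mul_of_nonneg_left (hstep n) hc.le
        _ = c * ((scale ω (n + 1) / scale ω m) ^ a *
            (branchWeight y (n + 1) * (scale ω m / scale ω (n + 1)) ^ a)) := by
          rw [mul_left_comm (_ ^ a), hinv, mul_one]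
        _ ≤ c * ((τ⁻¹ * (R / r)) ^ a * branchWeight y m) :=
          mul_le_mul_of_nonneg_left (mul_le_mul hq hw (mul_nonneg (branchWeight_pos y _).le
            (by positivity)) (by positivity)) hc.le
        _ = (τ⁻¹ * (R / r)) ^ a * (c * branchWeight y m) := by ring
        _ ≤ _ := mul_le_mul_of_nonneg_left (hstep m) (by positivity)
  calc _ ≤ branchWeight y n := hupp
    _ = (c ^ 2)⁻¹ * (c ^ 2 * branchWeight y n) := by
      rw [inv_mul_cancel_left₀ (by positivity)]
    _ ≤ (c ^ 2)⁻¹ * ((τ⁻¹ * (R / r)) ^ a * branchWeight y (m + 1)) :=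
      mul_le_mul_of_nonneg_left key (by positivity)
    _ ≤ (c ^ 2)⁻¹ * ((τ⁻¹ * (R / r)) ^ a * K.moranMeasure.real (Metric.ball (K.coding y) r)) := by
      gcongr
    _ = _ := by ring

end MoranConstruction

end RandomMoran

/-! ### Long runs of extreme steps and small dimension functions. -/

namespace RandomMoran

lemma tendsto_natLog_atTop {b : ℕ} (hb : 1 < b) : Tendsto (Nat.log b) atTop atTop :=
  tendsto_atTop.2 fun N => (eventually_ge_atTop (b ^ N)).mono fun _ hj =>
    (Nat.le_log_iff_pow_le hb (by have := Nat.pow_pos (n := N) (zero_lt_one.trans hb); omega)).2 hj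

section Runs

variable {ρ : ℕ → ℝ} {ω : SampleSpace ρ} {C : ℝ} {b : ℕ}

/-- A logarithmically long run of steps covers all the scales excluded by a small dimension
function. -/
lemma eventually_mul_scale_lt_rpow (hr : ∀ n, ratio (ω n) ≤ 1 / 2)
    (hC : ∀ n : ℕ, -Real.log (scale ω n) ≤ C * (n + 1)) (hb : 1 < b) {Φ : ℝ → ℝ}
    (hΦ : IsSmallDimensionFunction Φ) {a a' : ℝ} (ha : 0 < a) (ha' : 0 < a') :
    ∀ᶠ j : ℕ in atTop, a' * scale ω (j ^ 2 + Nat.log b j) <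
      (a * scale ω (j ^ 2)) ^ (1 + Φ (a * scale ω (j ^ 2))) := by
  obtain ⟨hdim, A, δ, hδ, hA, hAt⟩ := hΦ
  have hsq : Tendsto (fun j : ℕ => j ^ 2) atTop atTop := tendsto_pow_atTop two_ne_zero
  have hR0 : Tendsto (fun j : ℕ => a * scale ω (j ^ 2)) atTop (𝓝 0) := by
    simpa using ((tendsto_scale hr).comp hsq).const_mul a
  have hRpos : ∀ j : ℕ, 0 < a * scale ω (j ^ 2) := fun j => mul_pos ha (scale_pos _ _)
  have hR : Tendsto (fun j : ℕ => a * scale ω (j ^ 2)) atTop (𝓝[>] 0) :=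
    tendsto_nhdsWithin_iff.2 ⟨hR0, Eventually.of_forall hRpos⟩
  have hlogb : 0 < Real.log b := Real.log_pos (by exact_mod_cast hb)
  have hlog2 : 0 < Real.log 2 := Real.log_pos (by norm_num)
  have hLt : Tendsto (fun j : ℕ => (Nat.log b j : ℝ)) atTop atTop :=
    tendsto_natCast_atTop_atTop.comp (tendsto_natLog_atTop hb)
  -- As `log |log R| ≤ 3 * (L + 1) * log b`, the constant `6 * log b / log 2` makes `Φ R * |log R|`
  -- at most `(L + 1) / 2 * log 2`. This is about half of the `L * log 2` gained over the block; the
  -- last condition lets the other half absorb `a` and `a'`.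
  filter_upwards [(hAt.comp hR).eventually_ge_atTop (6 * Real.log b / Real.log 2),
    hR0.eventually_lt_const hδ, hR0.eventually_lt_const (Real.exp_pos (-1)),
    eventually_ge_atTop 1,
    tendsto_natCast_atTop_atTop.eventually_ge_atTop (|Real.log a| + 2 * max C 0),
    hLt.eventually_gt_atTop (2 / Real.log 2 * (Real.log 2 / 2 + Real.log a' - Real.log a))]
    with j h1 h2 h3 h4 h5 h6
  simp only [Function.comp_apply] at h1
  set L := Nat.log b j
  set s := scale ω (j ^ 2)
  have hs : 0 < s := scale_pos _ _
  set R := a * s with hRdef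
  have hRp : 0 < R := hRpos j
  have hlogR : Real.log R < -1 := by
    rw [Real.log_lt_iff_lt_exp hRp]; exact h3
  have hR1 : R < 1 := h3.trans (by rw [Real.exp_lt_one_iff]; norm_num)
  have hΦ0 : 0 ≤ Φ R := hdim.nonneg R ⟨hRp, hR1⟩
  have hj1 : (1 : ℝ) ≤ j := by exact_mod_cast h4
  have hlogRs : Real.log R = Real.log a + Real.log s := Real.log_mul ha.ne' hs.ne'
  -- The bound is really of order `j ^ 2`. One more factor `j` swallows the constants, and after a
  -- second logarithm only the exponent matters.
  have hl : -Real.log R ≤ (j : ℝ) ^ 3 := by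
    have hCj := hC (j ^ 2)
    push_cast at hCj
    have h7 : C * ((j : ℝ) ^ 2 + 1) ≤ max C 0 * (2 * (j : ℝ) ^ 2) :=
      mul_le_mul (le_max_left _ _) (by nlinarith) (by positivity) (le_max_right _ _)
    have h8 := neg_abs_le (Real.log a)
    have h9 : |Real.log a| ≤ |Real.log a| * (j : ℝ) ^ 2 :=
      le_mul_of_one_le_right (abs_nonneg _) (one_le_pow₀ hj1)
    calc -Real.log R ≤ (|Real.log a| + 2 * max C 0) * (j : ℝ) ^ 2 := by
          rw [hlogRs]; linarith
      _ ≤ j * (j : ℝ) ^ 2 := mul_le_mul_of_nonneg_right h5 (by positivity)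
      _ = (j : ℝ) ^ 3 := by ring
  have hjL : Real.log j ≤ (L + 1) * Real.log b := by
    rw [← Nat.cast_succ, ← Real.log_pow]
    refine Real.log_le_log (by linarith) ?_
    exact_mod_cast (Nat.lt_pow_succ_log_self hb j).le
  have hll : Real.log (-Real.log R) ≤ 3 * ((L + 1) * Real.log b) := by
    refine (Real.log_le_log (by linarith) hl).trans ?_
    rw [Real.log_pow]
    push_cast
    linarith
  have hAR : A R * Φ R ≤ Real.log |Real.log R| / |Real.log R| := hA R ⟨hRp, h2⟩
  rw [abs_of_neg (by linarith : Real.log R < 0), le_div_iff₀ (by linarith)] at hAR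
  have hx : Φ R * -Real.log R ≤ (L + 1) / 2 * Real.log 2 := by
    have h10 : 6 * Real.log b / Real.log 2 * (Φ R * -Real.log R) ≤
        3 * ((L + 1) * Real.log b) := by
      refine le_trans ?_ hll
      refine le_trans ?_ hAR
      rw [mul_assoc]
      exact mul_le_mul_of_nonneg_right h1 (mul_nonneg hΦ0 (by linarith))
    rw [div_mul_eq_mul_div, div_le_iff₀ hlog2] at h10
    nlinarith
  have hsL : Real.log (scale ω (j ^ 2 + L)) ≤ Real.log s - L * Real.log 2 := by
    have := Real.log_le_log (scale_pos _ _) (scale_add_le hr (j ^ 2) L)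
    rwa [Real.log_mul hs.ne' (by positivity), Real.log_pow, one_div, Real.log_inv, mul_neg,
      ← sub_eq_add_neg] at this
  rw [← Real.log_lt_log_iff (mul_pos ha' (scale_pos _ _)) (Real.rpow_pos_of_pos hRp _),
    Real.log_rpow hRp, Real.log_mul ha'.ne' (scale_pos _ _).ne']
  rw [div_mul_eq_mul_div, div_lt_iff₀ hlog2] at h6
  nlinarith

/-- The quotient is at least `2 ^ Nat.log b j`. Its divergence defeats the constant `C₂` in the
definition of the exponents. -/
lemma tendsto_scale_div_rpow (hr : ∀ n, ratio (ω n) ≤ 1 / 2) (hb : 1 < b) {e : ℝ} (he : 0 < e) :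
    Tendsto (fun j : ℕ => (scale ω (j ^ 2) / scale ω (j ^ 2 + Nat.log b j)) ^ e)
      atTop atTop := by
  refine (tendsto_rpow_atTop he).comp ?_
  refine tendsto_atTop_mono (fun j => ?_)
    ((tendsto_pow_atTop_atTop_of_one_lt (r := (2 : ℝ)) (by norm_num)).comp
      (tendsto_natLog_atTop hb))
  rw [Function.comp_apply, le_div_iff₀ (scale_pos _ _)]
  refine (mul_le_mul_of_nonneg_left (scale_add_le hr _ _) (by positivity)).trans (le_of_eq ?_)
  rw [mul_left_comm, ← mul_pow]
  norm_num

end Runs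

namespace MoranConstruction

variable {ρ : ℕ → ℝ} {E : Type*} [MetricSpace E] {I₀ : Set E} {τ : ℝ} {ω : SampleSpace ρ}
  [Nonempty E] [MeasurableSpace E] [BorelSpace E] {Φ : ℝ → ℝ} {C : ℝ} {b : ℕ} {c d : ℝ}

/-- Test the exponent at `R = τ * scale ω n` and `r = 2 * scale ω m`, the ends of a run, on the
branch of largest children. With `Q = scale ω n / scale ω m` this gives `C₂ * (τ / 2) ^ d * Q ^ d ≤
Q ^ c`, which is impossible for `c < d` as `Q` is unbounded. The factor `2` is there because balls
are open. -/
lemma le_of_mem_lowerExponents (K : MoranConstruction I₀ τ ω) (hI : IsCompact I₀) (hτ : 0 < τ)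
    (hd : Metric.diam I₀ = 1) (hr : ∀ n, ratio (ω n) ≤ 1 / 2)
    (hC : ∀ n : ℕ, -Real.log (scale ω n) ≤ C * (n + 1)) (hb : 1 < b)
    (hΦ : IsSmallDimensionFunction Φ)
    (hrun : ∃ᶠ j : ℕ in atTop, ∀ k ∈ Ico (j ^ 2) (j ^ 2 + Nat.log b j),
      ratio (ω k) ^ c ≤ maxProb (ω k))
    (hdl : d ∈ lowerExponents Φ K.moranMeasure) : d ≤ c := by
  by_contra! hcd
  obtain ⟨C₁, hC₁, C₂, hC₂, h⟩ := hdl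
  choose i hi using fun k => exists_prob_eq_maxProb (ω k)
  have hsq : Tendsto (fun j : ℕ => j ^ 2) atTop atTop := tendsto_pow_atTop two_ne_zero
  have hR0 : Tendsto (fun j : ℕ => τ * scale ω (j ^ 2)) atTop (𝓝 0) := by
    simpa using ((tendsto_scale hr).comp hsq).const_mul τ
  obtain ⟨j, hj, h1, h2, h3, h4⟩ := (hrun.and_eventually
    ((eventually_mul_scale_lt_rpow hr hC hb hΦ hτ two_pos).and
    ((hR0.eventually_lt_const one_pos).and ((hR0.eventually_lt_const hC₁).and
    ((tendsto_scale_div_rpow hr hb (sub_pos.2 hcd)).eventually_gt_atTop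
      (C₂ * (τ / 2) ^ d)⁻¹))))).exists
  set n := j ^ 2
  set m := n + Nat.log b j
  have hn := scale_pos ω n
  have hm := scale_pos ω m
  have hbn := branchWeight_pos (ω := ω) i n
  have hQ : 0 < scale ω n / scale ω m := div_pos hn hm
  have key := h (2 * scale ω m) (τ * scale ω n) (by positivity) (by positivity) h2 h3.le h1 _
    (K.coding_mem_support hI hτ hd hr i)
  have hw := le_branchWeight_of_le_prob (ω := ω) i (c := c) (Nat.le_add_right n (Nat.log b j))
    fun k hk => (hj k hk).trans_eq (hi k).symm
  have hup := K.ball_le_branchWeight hI hτ hd hr i (n := n) le_rfl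
  have hlo := K.branchWeight_le_ball hI hτ hd hr i (n := m) (s := 2 * scale ω m) (by linarith)
  rw [le_div_iff₀ (K.ball_real_pos hI hτ hd hr i (by positivity)),
    mul_div_mul_comm, Real.mul_rpow (by positivity) hQ.le] at key
  have hinv : (scale ω m / scale ω n) ^ c = ((scale ω n / scale ω m) ^ c)⁻¹ := by
    rw [← Real.inv_rpow hQ.le, inv_div]
  rw [hinv] at hw
  have hcons : C₂ * ((τ / 2) ^ d * (scale ω n / scale ω m) ^ d) *
      (branchWeight (ω := ω) i n * ((scale ω n / scale ω m) ^ c)⁻¹) ≤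
      branchWeight (ω := ω) i n :=
    (mul_le_mul_of_nonneg_left (hw.trans hlo) (by positivity)).trans (key.trans hup)
  have hX : 1 < C₂ * (τ / 2) ^ d * (scale ω n / scale ω m) ^ (d - c) := by
    rwa [inv_lt_iff_one_lt_mul₀' (by positivity)] at h4
  rw [Real.rpow_sub hQ] at hX
  have : C₂ * ((τ / 2) ^ d * (scale ω n / scale ω m) ^ d) *
      (branchWeight (ω := ω) i n * ((scale ω n / scale ω m) ^ c)⁻¹) =
      (C₂ * (τ / 2) ^ d * ((scale ω n / scale ω m) ^ d / (scale ω n / scale ω m) ^ c)) *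
      branchWeight (ω := ω) i n := by ring
  rw [this] at hcons
  nlinarith

lemma le_of_mem_upperExponents (K : MoranConstruction I₀ τ ω) (hI : IsCompact I₀) (hτ : 0 < τ)
    (hd : Metric.diam I₀ = 1) (hr : ∀ n, ratio (ω n) ≤ 1 / 2)
    (hC : ∀ n : ℕ, -Real.log (scale ω n) ≤ C * (n + 1)) (hb : 1 < b)
    (hΦ : IsSmallDimensionFunction Φ)
    (hrun : ∃ᶠ j : ℕ in atTop, ∀ k ∈ Ico (j ^ 2) (j ^ 2 + Nat.log b j),
      minProb (ω k) ≤ ratio (ω k) ^ c)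
    (hdu : d ∈ upperExponents Φ K.moranMeasure) : c ≤ d := by
  by_contra! hcd
  obtain ⟨C₁, hC₁, C₂, hC₂, h⟩ := hdu
  -- On the branch of smallest children the mass drops too fast. The factors `τ` and `2` trade
  -- places, since the large ball now needs a lower bound and the small one an upper bound.
  choose i hi using fun k => exists_prob_eq_minProb (ω k)
  have hsq : Tendsto (fun j : ℕ => j ^ 2) atTop atTop := tendsto_pow_atTop two_ne_zero
  have hR0 : Tendsto (fun j : ℕ => 2 * scale ω (j ^ 2)) atTop (𝓝 0) := by
    simpa using ((tendsto_scale hr).comp hsq).const_mul 2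
  obtain ⟨j, hj, h1, h2, h3, h4⟩ := (hrun.and_eventually
    ((eventually_mul_scale_lt_rpow hr hC hb hΦ two_pos hτ).and
    ((hR0.eventually_lt_const one_pos).and ((hR0.eventually_lt_const hC₁).and
    ((tendsto_scale_div_rpow hr hb (sub_pos.2 hcd)).eventually_gt_atTop
      (C₂ * (2 / τ) ^ d)))))).exists
  set n := j ^ 2
  set m := n + Nat.log b j
  have hn := scale_pos ω n
  have hm := scale_pos ω m
  have hbn := branchWeight_pos (ω := ω) i n
  have hQ : 0 < scale ω n / scale ω m := div_pos hn hm
  have key := h (τ * scale ω m) (2 * scale ω n) (by positivity) (by positivity) h2 h3.le h1 _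
    (K.coding_mem_support hI hτ hd hr i)
  have hw := branchWeight_le_of_prob_le (ω := ω) i (c := c) (Nat.le_add_right n (Nat.log b j))
    fun k hk => (hi k).trans_le (hj k hk)
  have hup := K.ball_le_branchWeight hI hτ hd hr i (n := m) le_rfl
  have hlo := K.branchWeight_le_ball hI hτ hd hr i (n := n) (s := 2 * scale ω n) (by linarith)
  rw [div_le_iff₀ (K.ball_real_pos hI hτ hd hr i (by positivity)),
    mul_div_mul_comm, Real.mul_rpow (by positivity) hQ.le] at key
  have hinv : (scale ω m / scale ω n) ^ c = ((scale ω n / scale ω m) ^ c)⁻¹ := by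
    rw [← Real.inv_rpow hQ.le, inv_div]
  rw [hinv] at hw
  have hcons : branchWeight (ω := ω) i n ≤ C₂ * ((2 / τ) ^ d * (scale ω n / scale ω m) ^ d) *
      (branchWeight (ω := ω) i n * ((scale ω n / scale ω m) ^ c)⁻¹) :=
    hlo.trans (key.trans (mul_le_mul_of_nonneg_left (hup.trans hw) (by positivity)))
  have hX : C₂ * (2 / τ) ^ d * (scale ω n / scale ω m) ^ d * ((scale ω n / scale ω m) ^ c)⁻¹
      < 1 := by
    rw [← div_eq_mul_inv, div_lt_one (by positivity)]
    rwa [Real.rpow_sub hQ, lt_div_iff₀ (by positivity)] at h4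
  have : C₂ * ((2 / τ) ^ d * (scale ω n / scale ω m) ^ d) *
      (branchWeight (ω := ω) i n * ((scale ω n / scale ω m) ^ c)⁻¹) =
      (C₂ * (2 / τ) ^ d * (scale ω n / scale ω m) ^ d * ((scale ω n / scale ω m) ^ c)⁻¹) *
      branchWeight (ω := ω) i n := by ring
  rw [this] at hcons
  nlinarith

end MoranConstruction

end RandomMoran

/-! ### Almost sure properties of the sequence of steps. -/

namespace RandomMoran

section Measurability

variable {ρ : ℕ → ℝ}

lemma measurable_stepSpace {β : Type*} [MeasurableSpace β] {f : StepSpace ρ → β}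
    (h : ∀ t, Measurable fun p => f ⟨t, p⟩) : Measurable f := fun _ hs =>
  MeasurableSpace.measurableSet_iInf.2 fun t => h t hs

lemma measurable_ratio : Measurable (ratio : StepSpace ρ → ℝ) :=
  measurable_stepSpace fun _ => measurable_subtype_coe.comp measurable_fst

lemma measurable_prob_mk (t : {t : ℕ // 2 ≤ t}) (i : Fin t) :
    Measurable fun p : Ioc (0 : ℝ) (ρ t) × openSimplex t => p.2.1 i :=
  (measurable_pi_apply i).comp (measurable_subtype_coe.comp measurable_snd)

lemma measurable_maxProb : Measurable (maxProb : StepSpace ρ → ℝ) :=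
  measurable_stepSpace fun t => by
    have h := Measurable.iSup (measurable_prob_mk (ρ := ρ) t)
    exact h

lemma measurable_minProb : Measurable (minProb : StepSpace ρ → ℝ) :=
  measurable_stepSpace fun t => by
    have h := Measurable.iInf (measurable_prob_mk (ρ := ρ) t)
    exact h

end Measurability

section Sampling

variable {ρ : ℕ → ℝ} (π : Measure (StepSpace ρ)) [IsProbabilityMeasure π]

instance : IsProbabilityMeasure (sampleMeasure π) := by
  unfold sampleMeasure; infer_instance

lemma ae_sampleMeasure_eval (n : ℕ) {p : StepSpace ρ → Prop} (h : ∀ᵐ a ∂π, p a) :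
    ∀ᵐ ω ∂sampleMeasure π, p (ω n) :=
  (measurePreserving_eval_infinitePi (fun _ : ℕ => π) n).quasiMeasurePreserving.ae h

/-- An almost sure property of the first step holds almost surely at all steps. -/
lemma ae_forall_step {p : StepSpace ρ → Prop} (hp : MeasurableSet {a | p a})
    (h : ∀ᵐ ω ∂sampleMeasure π, p (ω 0)) : ∀ᵐ ω ∂sampleMeasure π, ∀ n, p (ω n) := by
  have h0 : ∀ᵐ a ∂π, p a := by
    rw [← (measurePreserving_eval_infinitePi (fun _ : ℕ => π) 0).map_eq,
      ae_map_iff (measurePreserving_eval_infinitePi (fun _ : ℕ => π) 0).measurable.aemeasurable hp]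
    exact h
  exact ae_all_iff.2 fun n => ae_sampleMeasure_eval π n h0

/-- An event of positive probability occurs almost surely in infinitely many logarithmically
long runs. -/
lemma ae_frequently_run {G : Set (StepSpace ρ)} (hG : MeasurableSet G) (hpos : π G ≠ 0) :
    ∃ b : ℕ, 1 < b ∧ ∀ᵐ ω ∂sampleMeasure π, ∃ᶠ j : ℕ in atTop,
      ∀ k ∈ Ico (j ^ 2) (j ^ 2 + Nat.log b j), ω k ∈ G := by
  obtain ⟨b₀, hb₀⟩ := ENNReal.exists_nat_gt (ENNReal.inv_ne_top.2 hpos)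
  -- With `1 / b ≤ π G`, a block of `Nat.log b j` steps lies in `G` with probability at least `b ^
  -- (-Nat.log b j) ≥ 1 / j`.
  set b := b₀ + 2
  have hb : 1 < b := by omega
  have hbG : (b : ENNReal)⁻¹ ≤ π G := by
    rw [ENNReal.inv_le_iff_inv_le]
    exact hb₀.le.trans (by exact_mod_cast Nat.le_add_right b₀ 2)
  refine ⟨b, hb, ?_⟩
  set I : ℕ → Finset ℕ := fun j => Finset.Ico (j ^ 2) (j ^ 2 + Nat.log b j)
  set S : ℕ → Set (SampleSpace ρ) := fun j => Set.pi (I j) fun _ => G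
  -- A block has length at most `i`, less than the gap `2 * i + 1` between consecutive squares.
  have hI : Pairwise (Function.onFun Disjoint I) := by
    refine (pairwise_disjoint_on I).2 fun i j hij => ?_
    rw [Finset.disjoint_left]
    intro k hk hk'
    rw [Finset.mem_Ico] at hk hk'
    have := Nat.log_le_self b i
    nlinarith [hk.2, hk'.1]
  have hpi : ∀ J : Finset ℕ, sampleMeasure π (Set.pi J fun _ => G) = ∏ _k ∈ J, π G :=
    fun J => Measure.infinitePi_pi _ fun _ _ => hG
  have hSm : ∀ j, MeasurableSet (S j) := fun j =>
    MeasurableSet.pi (Finset.countable_toSet _) fun _ _ => hG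
  have hind : ProbabilityTheory.iIndepSet S (sampleMeasure π) := by
    rw [ProbabilityTheory.iIndepSet_iff_meas_biInter hSm]
    intro s
    have hs : ⋂ j ∈ s, S j = Set.pi (s.biUnion I) fun _ => G := by
      ext ω
      simp only [S, mem_iInter, Set.mem_pi, Finset.mem_coe, Finset.mem_biUnion]
      exact ⟨fun h k ⟨j, hj, hk⟩ => h j hj k hk, fun h j hj k hk => h k ⟨j, hj, hk⟩⟩
    rw [hs, hpi, Finset.prod_biUnion (hI.set_pairwise _)]
    exact Finset.prod_congr rfl fun j _ => (hpi _).symm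
  have hsum : ∑' j, sampleMeasure π (S j) = ⊤ := by
    -- The shift to `j + 1` is for `j = 0`, where the inverse would be `⊤`.
    have hle : ∀ j : ℕ, ((j + 1 : ℕ) : ENNReal)⁻¹ ≤ sampleMeasure π (S j) := by
      intro j
      rw [hpi, Finset.prod_const, Nat.card_Ico, Nat.add_sub_cancel_left]
      refine le_trans ?_ (pow_le_pow_left₀ zero_le hbG _)
      rw [← ENNReal.inv_pow, ENNReal.inv_le_inv]
      rcases eq_or_ne j 0 with rfl | hj
      · simp
      · exact_mod_cast (Nat.pow_log_le_self b hj).trans j.le_succ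
    refine top_le_iff.1 (le_trans ?_ (ENNReal.tsum_le_tsum hle))
    rw [top_le_iff]
    by_contra hne
    have := ENNReal.summable_toReal hne
    simp only [ENNReal.toReal_inv, ENNReal.toReal_natCast] at this
    exact Real.not_summable_natCast_inv ((summable_nat_add_iff 1).1 this)
  have h1 := ProbabilityTheory.measure_limsup_eq_one hSm hind hsum
  rw [← prob_compl_eq_zero_iff (MeasurableSet.measurableSet_limsup hSm)] at h1
  filter_upwards [compl_mem_ae_iff.2 h1] with ω hω
  rw [compl_compl, mem_limsup_iff_frequently_mem] at hω
  refine hω.mono fun j hj k hk => hj k ?_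
  simpa [I] using hk

/-- The logarithms of the scales grow at most linearly. -/
lemma ae_exists_neg_log_scale_le (hr : ∀ a : StepSpace ρ, ratio a ≤ 1 / 2)
    (hZ : ∃ A > 0, ∀ l : ℝ, |l| ≤ A → Integrable
      (fun ω : SampleSpace ρ => Real.exp (l * -Real.log (ratio (ω 0)))) (sampleMeasure π)) :
    ∀ᵐ ω ∂sampleMeasure π, ∃ C : ℝ, ∀ n : ℕ, -Real.log (scale ω n) ≤ C * (n + 1) := by
  obtain ⟨A, hA, hint⟩ := hZ
  set g : StepSpace ρ → ℝ := fun a => -Real.log (ratio a)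
  have hg : Measurable g := measurable_ratio.log.neg
  have hg0 : ∀ a, 0 ≤ g a := fun a =>
    neg_nonneg.2 (Real.log_nonpos (ratio_pos a).le ((hr a).trans (by norm_num)))
  have hgm : ∀ n, Measurable fun ω : SampleSpace ρ => g (ω n) := fun n =>
    hg.comp (measurable_pi_apply n)
  -- The exponential moment dominates the first moment, because `A * g ≤ exp (A * g)`.
  have hgi : Integrable (fun ω : SampleSpace ρ => g (ω 0)) (sampleMeasure π) := by
    refine ((hint A (abs_of_pos hA).le).const_mul A⁻¹).mono' (hgm 0).aestronglyMeasurable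
      (Eventually.of_forall fun ω => ?_)
    rw [Real.norm_of_nonneg (hg0 _), ← div_eq_inv_mul, le_div_iff₀' hA]
    linarith [Real.add_one_le_exp (A * -Real.log (ratio (ω 0)))]
  have hindep : Pairwise (Function.onFun (ProbabilityTheory.IndepFun · · (sampleMeasure π))
      fun n (ω : SampleSpace ρ) => g (ω n)) := fun i j hij =>
    (ProbabilityTheory.iIndepFun_infinitePi (P := fun _ : ℕ => π) (X := fun _ => g)
      fun _ => hg).indepFun hij
  have hident : ∀ n, ProbabilityTheory.IdentDistrib (fun ω : SampleSpace ρ => g (ω n))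
      (fun ω => g (ω 0)) (sampleMeasure π) (sampleMeasure π) := fun n => by
    refine ⟨(hgm n).aemeasurable, (hgm 0).aemeasurable, ?_⟩
    have key : ∀ m, (sampleMeasure π).map (fun ω : SampleSpace ρ => g (ω m)) = π.map g :=
      fun m => by
        have h := (measurePreserving_eval_infinitePi (fun _ : ℕ => π) m).map_eq
        conv_rhs => rw [← h, Measure.map_map hg (measurable_pi_apply m)]
        rfl
    rw [key, key]
  filter_upwards [ProbabilityTheory.strong_law_ae_real _ hgi hindep hident] with ω hω
  obtain ⟨C, hC⟩ := hω.bddAbove_range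
  refine ⟨|C|, fun n => ?_⟩
  have hsum : -Real.log (scale ω n) = ∑ k ∈ Finset.range n, g (ω k) := by
    rw [scale, Real.log_prod fun k _ => (ratio_pos _).ne', Finset.sum_neg_distrib]
  rw [hsum]
  rcases Nat.eq_zero_or_pos n with rfl | hn
  · simp
  · have hn' : (0 : ℝ) < n := by exact_mod_cast hn
    have h1 := hC (mem_range_self n)
    rw [div_le_iff₀ hn'] at h1
    nlinarith [le_abs_self C, abs_nonneg C]

lemma logRatio_neg (hr : ∀ a : StepSpace ρ, ratio a ≤ 1 / 2) (a : StepSpace ρ) :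
    Real.log (ratio a) < 0 :=
  Real.log_neg (ratio_pos a) ((hr a).trans_lt (by norm_num))

/-- Were the event null, the quotient of logarithms would be at least `q` almost surely, and so
would its essential infimum. Inequalities flip because `log r` is negative. -/
lemma ae_runs_of_beta_lt (hr : ∀ a : StepSpace ρ, ratio a ≤ 1 / 2) {q : ℝ}
    (hq : beta π < (q : EReal)) :
    ∃ b : ℕ, 1 < b ∧ ∀ᵐ ω ∂sampleMeasure π, ∃ᶠ j : ℕ in atTop,
      ∀ k ∈ Ico (j ^ 2) (j ^ 2 + Nat.log b j), ratio (ω k) ^ q ≤ maxProb (ω k) := by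
  refine ae_frequently_run π (G := {a | ratio a ^ q ≤ maxProb a})
    (measurableSet_le (measurable_ratio.pow_const q) measurable_maxProb) fun h0 => ?_
  refine not_le.2 hq (le_essInf_of_ae_le _ ?_)
  filter_upwards [ae_sampleMeasure_eval π 0 (compl_mem_ae_iff.2 h0)] with ω hω
  replace hω : maxProb (ω 0) < ratio (ω 0) ^ q := not_le.1 hω
  rw [EReal.coe_le_coe_iff, le_div_iff_of_neg (logRatio_neg hr _),
    ← Real.log_rpow (ratio_pos _)]
  exact Real.log_le_log (maxProb_pos _) hω.le

lemma ae_runs_of_lt_alpha (hr : ∀ a : StepSpace ρ, ratio a ≤ 1 / 2) {q : ℝ}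
    (hq : (q : EReal) < alpha π) :
    ∃ b : ℕ, 1 < b ∧ ∀ᵐ ω ∂sampleMeasure π, ∃ᶠ j : ℕ in atTop,
      ∀ k ∈ Ico (j ^ 2) (j ^ 2 + Nat.log b j), minProb (ω k) ≤ ratio (ω k) ^ q := by
  refine ae_frequently_run π (G := {a | minProb a ≤ ratio a ^ q})
    (measurableSet_le measurable_minProb (measurable_ratio.pow_const q)) fun h0 => ?_
  refine not_le.2 hq (essSup_le_of_ae_le _ ?_)
  filter_upwards [ae_sampleMeasure_eval π 0 (compl_mem_ae_iff.2 h0)] with ω hω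
  replace hω : ratio (ω 0) ^ q < minProb (ω 0) := not_le.1 hω
  rw [EReal.coe_le_coe_iff, div_le_iff_of_neg (logRatio_neg hr _),
    ← Real.log_rpow (ratio_pos _)]
  exact Real.log_le_log (Real.rpow_pos_of_pos (ratio_pos _) _) hω.le

lemma ae_forall_essInf_le {f : StepSpace ρ → EReal} (hf : Measurable f) :
    ∀ᵐ ω ∂sampleMeasure π, ∀ n,
      essInf (fun ω : SampleSpace ρ => f (ω 0)) (sampleMeasure π) ≤ f (ω n) :=
  ae_forall_step π (measurableSet_le measurable_const hf) ae_essInf_le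

lemma ae_forall_le_essSup {f : StepSpace ρ → EReal} (hf : Measurable f) :
    ∀ᵐ ω ∂sampleMeasure π, ∀ n,
      f (ω n) ≤ essSup (fun ω : SampleSpace ρ => f (ω 0)) (sampleMeasure π) :=
  ae_forall_step π (measurableSet_le hf measurable_const) ae_le_essSup

end Sampling

lemma exists_pos_le_of_pos_le {x : EReal} (hx : 0 < x) {f : ℕ → ℝ}
    (h : ∀ n, x ≤ (f n : EReal)) : ∃ c : ℝ, 0 < c ∧ ∀ n, c ≤ f n := by
  obtain ⟨c, h0, hc⟩ := EReal.lt_iff_exists_real_btwn.1 hx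
  exact ⟨c, by exact_mod_cast h0, fun n => EReal.coe_le_coe_iff.1 (hc.le.trans (h n))⟩

end RandomMoran

/-! ### Assembly of the theorem. -/

open RandomMoran

theorem mainTheorem2 {D : ℕ} (I₀ : Set (EuclideanSpace ℝ (Fin D)))
    (hI₀_compact : IsCompact I₀) (hI₀_diam : Metric.diam I₀ = 1)
    (hI₀_interior : (interior I₀).Nonempty)
    (τ : ℝ) (hτ_pos : 0 < τ) (hτ_lt : τ < 1)
    (ρ : ℕ → ℝ)
    (hρ : ∀ t, 2 ≤ t → 0 < ρ t ∧ ρ t ≤ 1 / 2 ∧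
      ∀ r, 0 < r → r ≤ ρ t → RandomMoran.HasSeparationProperty I₀ t r τ)
    (π : MeasureTheory.Measure (RandomMoran.StepSpace ρ))
    [MeasureTheory.IsProbabilityMeasure π]
    (hZ : ∃ A > 0, ∀ l : ℝ, |l| ≤ A →
      MeasureTheory.Integrable
        (fun ω : RandomMoran.SampleSpace ρ =>
          Real.exp (l * -Real.log (RandomMoran.ratio (ω 0))))
        (RandomMoran.sampleMeasure π))
    (K : ∀ ω : RandomMoran.SampleSpace ρ, RandomMoran.MoranConstruction I₀ τ ω) :
    ∃ Γ : Set (RandomMoran.SampleSpace ρ),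
      MeasurableSet Γ ∧ RandomMoran.sampleMeasure π Γ = 1 ∧
      (∀ Φ, RandomMoran.IsSmallDimensionFunction Φ → ∀ ω ∈ Γ,
        RandomMoran.lowerDim Φ (K ω).moranMeasure ≤ RandomMoran.beta π ∧
        RandomMoran.alpha π ≤ RandomMoran.upperDim Φ (K ω).moranMeasure) ∧
      ((0 < essInf (fun ω : RandomMoran.SampleSpace ρ =>
            ((RandomMoran.maxProb (ω 0) : ℝ) : EReal)) (RandomMoran.sampleMeasure π) ∨
          0 < essInf (fun ω : RandomMoran.SampleSpace ρ =>
            ((RandomMoran.ratio (ω 0) : ℝ) : EReal)) (RandomMoran.sampleMeasure π)) →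
        ∀ Φ, RandomMoran.IsDimensionFunction Φ → ∀ ω ∈ Γ,
          RandomMoran.beta π ≤ RandomMoran.lowerDim Φ (K ω).moranMeasure) ∧
      ((0 < essInf (fun ω : RandomMoran.SampleSpace ρ =>
            ((RandomMoran.minProb (ω 0) : ℝ) : EReal)) (RandomMoran.sampleMeasure π) ∨
          0 < essInf (fun ω : RandomMoran.SampleSpace ρ =>
            ((RandomMoran.ratio (ω 0) : ℝ) : EReal)) (RandomMoran.sampleMeasure π)) →
        ∀ Φ, RandomMoran.IsDimensionFunction Φ → ∀ ω ∈ Γ,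
          RandomMoran.upperDim Φ (K ω).moranMeasure ≤ RandomMoran.alpha π) := by
  have hr : ∀ a : StepSpace ρ, ratio a ≤ 1 / 2 := fun a => a.2.1.2.2.trans (hρ a.1 a.1.2).2.1
  have hmeas : ∀ {g : StepSpace ρ → ℝ}, Measurable g →
      Measurable fun a => ((Real.log (g a) / Real.log (ratio a) : ℝ) : EReal) := fun hg =>
    (hg.log.div measurable_ratio.log).coe_real_ereal
  -- Rational `q` suffice to separate an exponent from `β`, and keep the number of null sets
  -- countable. The base `b` depends on `q`, but nothing here depends on `Φ`, so one `Γ` serves all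
  -- dimension functions.
  have hβruns : ∀ᵐ ω ∂sampleMeasure π, ∀ q : ℚ, beta π < ((q : ℝ) : EReal) →
      ∃ b : ℕ, 1 < b ∧ ∃ᶠ j : ℕ in atTop, ∀ k ∈ Ico (j ^ 2) (j ^ 2 + Nat.log b j),
        ratio (ω k) ^ (q : ℝ) ≤ maxProb (ω k) := by
    refine ae_all_iff.2 fun q => eventually_imp_distrib_left.2 fun hq => ?_
    obtain ⟨b, hb, h⟩ := ae_runs_of_beta_lt π hr hq
    exact h.mono fun ω hω => ⟨b, hb, hω⟩
  have hαruns : ∀ᵐ ω ∂sampleMeasure π, ∀ q : ℚ, ((q : ℝ) : EReal) < alpha π →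
      ∃ b : ℕ, 1 < b ∧ ∃ᶠ j : ℕ in atTop, ∀ k ∈ Ico (j ^ 2) (j ^ 2 + Nat.log b j),
        minProb (ω k) ≤ ratio (ω k) ^ (q : ℝ) := by
    refine ae_all_iff.2 fun q => eventually_imp_distrib_left.2 fun hq => ?_
    obtain ⟨b, hb, h⟩ := ae_runs_of_lt_alpha π hr hq
    exact h.mono fun ω hω => ⟨b, hb, hω⟩
  obtain ⟨Γ, hΓae, hΓm, hΓ⟩ := ((ae_exists_neg_log_scale_le π hr hZ).and (hβruns.and (hαruns.and
    ((ae_forall_essInf_le π (hmeas measurable_maxProb)).and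
    ((ae_forall_le_essSup π (hmeas measurable_minProb)).and
    ((ae_forall_essInf_le π measurable_ratio.coe_real_ereal).and
    ((ae_forall_essInf_le π measurable_maxProb.coe_real_ereal).and
    (ae_forall_essInf_le π measurable_minProb.coe_real_ereal)))))))).exists_measurable_mem
  refine ⟨Γ, hΓm, (mem_ae_iff_prob_eq_one hΓm).1 hΓae, ?_, ?_, ?_⟩
  · intro Φ hΦ ω hω
    obtain ⟨⟨C, hC⟩, hβ, hα, -⟩ := hΓ ω hω
    constructor
    · refine iSup₂_le fun d hd => ?_
      by_contra! hlt
      obtain ⟨q, hq1, hq2⟩ := EReal.lt_iff_exists_rat_btwn.1 hlt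
      obtain ⟨b, hb, hrun⟩ := hβ q hq1
      exact not_le.2 (EReal.coe_lt_coe_iff.1 hq2) ((K ω).le_of_mem_lowerExponents hI₀_compact
        hτ_pos hI₀_diam (fun n => hr _) hC hb hΦ hrun hd)
    · refine le_iInf₂ fun d hd => ?_
      by_contra! hlt
      obtain ⟨q, hq1, hq2⟩ := EReal.lt_iff_exists_rat_btwn.1 hlt
      obtain ⟨b, hb, hrun⟩ := hα q hq2
      exact not_le.2 (EReal.coe_lt_coe_iff.1 hq1) ((K ω).le_of_mem_upperExponents hI₀_compact
        hτ_pos hI₀_diam (fun n => hr _) hC hb hΦ hrun hd)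
  · intro hess Φ hΦ ω hω
    obtain ⟨-, -, -, hβ, -, hrat, hM, -⟩ := hΓ ω hω
    replace hβ : ∀ n, beta π ≤
        ((Real.log (maxProb (ω n)) / Real.log (ratio (ω n)) : ℝ) : EReal) := hβ
    -- The exponent `0` is always admissible. For positive `β` the power `b⁻¹` below is meaningful.
    rcases le_or_gt (beta π) 0 with h0 | h0
    · exact h0.trans (le_iSup₂_of_le 0 ((K ω).zero_mem_lowerExponents hI₀_compact hτ_pos hI₀_diam
        (fun n => hr _) hΦ) le_rfl)
    lift beta π to ℝ using ⟨((hβ 0).trans_lt (EReal.coe_lt_top _)).ne, h0.bot_lt.ne'⟩ with b hbeq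
    have hb : 0 < b := by exact_mod_cast h0
    have hMb : ∀ n, maxProb (ω n) ≤ ratio (ω n) ^ b := fun n => by
      have h := EReal.coe_le_coe_iff.1 (hβ n)
      rw [le_div_iff_of_neg (logRatio_neg hr _), ← Real.log_rpow (ratio_pos _)] at h
      exact (Real.log_le_log_iff (maxProb_pos _) (Real.rpow_pos_of_pos (ratio_pos _) _)).1 h
    -- Both alternatives bound the ratios below: `c ≤ maxProb ≤ ratio ^ b` forces `c ^ b⁻¹ ≤ ratio`.
    obtain ⟨c, hc, hcr⟩ : ∃ c : ℝ, 0 < c ∧ ∀ n, c ≤ ratio (ω n) := by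
      rcases hess with h | h
      · obtain ⟨c, hc, hcM⟩ := exists_pos_le_of_pos_le h hM
        refine ⟨c ^ b⁻¹, Real.rpow_pos_of_pos hc _, fun n => ?_⟩
        exact (Real.rpow_inv_le_iff_of_pos hc.le (ratio_pos _).le hb).2 ((hcM n).trans (hMb n))
      · exact exists_pos_le_of_pos_le h hrat
    exact le_iSup₂_of_le b ((K ω).mem_lowerExponents hI₀_compact hτ_pos hI₀_diam
      (fun n => hr _) hΦ hb.le hc hcr hMb) le_rfl
  · intro hess Φ hΦ ω hω
    obtain ⟨-, -, -, -, hα, hrat, -, hm⟩ := hΓ ω hω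
    replace hα : ∀ n, ((Real.log (minProb (ω n)) / Real.log (ratio (ω n)) : ℝ) : EReal) ≤
        alpha π := hα
    have h0 : 0 ≤ alpha π := by
      refine le_trans ?_ (hα 0)
      exact_mod_cast div_nonneg_of_nonpos (Real.log_nonpos (minProb_pos _).le (minProb_le_one _))
        (logRatio_neg hr _).le
    rcases eq_or_ne (alpha π) ⊤ with htop | htop
    · rw [htop]; exact le_top
    lift alpha π to ℝ using ⟨htop, (EReal.bot_lt_zero.trans_le h0).ne'⟩ with a haeq
    have ha : 0 ≤ a := by exact_mod_cast h0
    have hma : ∀ n, ratio (ω n) ^ a ≤ minProb (ω n) := fun n => by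
      have h := EReal.coe_le_coe_iff.1 (hα n)
      rw [div_le_iff_of_neg (logRatio_neg hr _), ← Real.log_rpow (ratio_pos _)] at h
      exact (Real.log_le_log_iff (Real.rpow_pos_of_pos (ratio_pos _) _) (minProb_pos _)).1 h
    -- Dually, both alternatives bound the smallest probabilities below, by `minProb ≥ ratio ^ a ≥ c
    -- ^ a` in the second.
    obtain ⟨c, hc, hcm⟩ : ∃ c : ℝ, 0 < c ∧ ∀ n, c ≤ minProb (ω n) := by
      rcases hess with h | h
      · exact exists_pos_le_of_pos_le h hm
      · obtain ⟨c, hc, hcr⟩ := exists_pos_le_of_pos_le h hrat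
        exact ⟨c ^ a, Real.rpow_pos_of_pos hc _, fun n =>
          (Real.rpow_le_rpow hc.le (hcr n) ha).trans (hma n)⟩
    exact iInf₂_le_of_le a ((K ω).mem_upperExponents hI₀_compact hτ_pos hτ_lt hI₀_diam
      (fun n => hr _) hΦ ha hc hcm hma) le_rfl
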